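/- Let $(Q,\mathfrak m,k)$ be a regular local ring with algebraically closed residue field $k$, let $f=f_1,\dots,f_c$ be a $Q$-regular sequence in $\mathfrak m$, and let $R=Q/(f_1,\dots,f_c)$. Let $C,D\in K_{tac}(R)$, that is, $C$ and $D$ are $\mathbb Z$-indexed complexes of finitely generated free $R$-modules that are exact and whose duals $\mathrm{Hom}_R(C,R)$, $\mathrm{Hom}_R(D,R)$ are exact. Write $\mathrm{Hom}_R(C,\Sigma^iD)$ for the $R$-module of homotopy classes of chain maps $C\to\Sigma^iD$, where $(\Sigma^iD)_n=D_{n-i}$. Lift the differentials of $C$ to maps $\widetilde d$ of free $Q$-modules, write $\widetilde d\circ\widetilde d=\sum_{k=1}^c f_k\widetilde t_k$, and let $t_k\colon C\to\Sigma^2C$ be the chain map induced by $\widetilde t_k\otimes_QR$; its homotopy class does not depend on the choices, and $t_jt_k\sim t_kt_j$. Let $\chi_k$ act on $\bigoplus_{i\ge 0}\mathrm{Hom}_R(C,\Sigma^iD)$ by composition with $t_k$, as a map of degree $2$. This makes $E=\bigoplus_{i\ge0}\mathrm{Hom}_R(C,\Sigma^iD)\otimes_Rk$ a $k[\chi_1,\dots,\chi_c]$-module.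 Put $$V(Q,f,C,D)=\{b\in k^c \mid \varphi(b)=0\ \text{for all}\ \varphi\in\mathrm{Ann}_{k[\chi_1,\dots,\chi_c]}E\}\cup\{0\}.$$ Then $\mathrm{Hom}_R(C,\Sigma^iD)=0$ for all $i\gg0$ if and only if $V(Q,f,C,D)=\{0\}$. -/

import Mathlib

open CategoryTheory

universe u

noncomputable section

namespace TotallyAcyclic

/-! ## Totally acyclic complexes and their morphisms up to homotopy

Complexes are indexed cohomologically: the module `C_n` of a chain complex sits in degree `-n`.
With this indexing the shift `C⟦i⟧` of Mathlib, `(C⟦i⟧)^n = C^(n+i)` with differential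
`(-1)^i d`, is the complex `Σ^i C` with `(Σ^i C)_n = C_(n-i)`. -/

/-- A totally acyclic complex of `R`-modules: a `ℤ`-indexed complex `X` of finitely generated free
modules that is exact and whose dual `Hom_R(X, R)` is exact. -/
structure Ktac (R : Type u) [CommRing R] where
  /-- the underlying complex -/
  X : CochainComplex (ModuleCat.{u} R) ℤ
  free : ∀ n, Module.Free R (X.X n)
  finite : ∀ n, Module.Finite R (X.X n)
  exact : X.Acyclic
  exact_dual : ∀ n : ℤ,
    Function.Exact (X.d (n + 1) (n + 2)).hom.dualMap (X.d n (n + 1)).hom.dualMap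

/-- The object of the homotopy category given by a complex. -/
abbrev toK {R : Type u} [CommRing R] (C : CochainComplex (ModuleCat.{u} R) ℤ) :
    HomotopyCategory (ModuleCat.{u} R) (ComplexShape.up ℤ) :=
  (HomotopyCategory.quotient (ModuleCat.{u} R) (ComplexShape.up ℤ)).obj C

/-- `Hom_R(C, Σ^i D)`: the `R`-module of homotopy classes of chain maps from `C` to `Σ^i D`. -/
abbrev HomShift {R : Type u} [CommRing R] (C D : CochainComplex (ModuleCat.{u} R) ℤ) (i : ℤ) :
    Type u :=
  ShiftedHom (toK C) (toK D) i

/-- Two chain maps `C → Σ^n D`, `n` even, that differ by `τ d + d τ` are equal up to homotopy. -/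
theorem quotient_map_eq {R : Type u} [CommRing R] {C D : CochainComplex (ModuleCat.{u} R) ℤ}
    {n : ℤ} (hn : Even n) (a b : C ⟶ D⟦n⟧) (τ : ∀ p q : ℤ, C.X p →ₗ[R] D.X q)
    (h : ∀ p : ℤ, (a.f p).hom - (b.f p).hom =
      τ (p + 1) (p + n) ∘ₗ (C.d p (p + 1)).hom +
        (D.d (p - 1 + n) (p + n)).hom ∘ₗ τ p (p - 1 + n)) :
    (HomotopyCategory.quotient _ _).map a = (HomotopyCategory.quotient _ _).map b := by
  obtain ⟨g, hg⟩ : ∃ g : ∀ i j : ℤ, C.X i ⟶ (D⟦n⟧).X j,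
      ∀ i j, g i j = ModuleCat.ofHom (τ i (j + n)) := ⟨fun i j => _, fun i j => rfl⟩
  apply HomotopyCategory.eq_of_homotopy
  refine
    { hom := fun i j => if j + 1 = i then g i j else 0
      zero := fun i j hij => if_neg hij
      comm := fun i => ?_ }
  rw [dNext_eq _ (show (ComplexShape.up ℤ).Rel i (i + 1) by simp),
    prevD_eq _ (show (ComplexShape.up ℤ).Rel (i - 1) i by simp)]
  rw [if_pos rfl, if_pos (by ring), hg, hg]
  have h2 : (D⟦n⟧).d (i - 1) i = D.d (i - 1 + n) (i + n) := by
    rw [CochainComplex.shiftFunctor_obj_d', Int.negOnePow_even _ hn, one_smul]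
  rw [h2]
  apply ModuleCat.hom_ext
  exact sub_eq_iff_eq_add.1 (h i)

/-! ## Quotients by regular sequences -/

/-- The ring `R = Q/(f₁, …, f_c)`. -/
abbrev QuotRing {Q : Type u} [CommRing Q] {c : ℕ} (f : Fin c → Q) : Type u :=
  Q ⧸ Ideal.span (Set.range f)

theorem ofList_ofFn {Q : Type u} [CommRing Q] {c : ℕ} (f : Fin c → Q) :
    Ideal.ofList (List.ofFn f) = Ideal.span (Set.range f) := by
  unfold Ideal.ofList
  congr 1
  ext x
  simp [List.mem_ofFn]

theorem span_ne_top {Q : Type u} [CommRing Q] {c : ℕ} (f : Fin c → Q)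
    (hf : RingTheory.Sequence.IsRegular Q (List.ofFn f)) :
    Ideal.span (Set.range f) ≠ ⊤ := by
  intro h
  apply hf.top_ne_smul
  rw [ofList_ofFn, h]
  simp

/-- A relation among the members of a weakly regular sequence has its coefficients in the ideal
that the sequence generates. -/
theorem mem_span_of_sum_eq_zero {Q : Type u} [CommRing Q] : ∀ {c : ℕ} (f : Fin c → Q)
    (_ : RingTheory.Sequence.IsWeaklyRegular Q (List.ofFn f)) (x : Fin c → Q)
    (_ : ∑ k, f k * x k = 0) (k : Fin c), x k ∈ Ideal.span (Set.range f) := by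
  intro c
  induction c with
  | zero => intro f _ x _ k; exact k.elim0
  | succ c ih =>
    intro f hf x hx
    set g : Fin c → Q := fun i => f i.castSucc with hg
    have hsplit : List.ofFn f = List.ofFn g ++ [f (Fin.last c)] := by
      rw [List.ofFn_succ']; simp [hg, List.concat_eq_append]
    rw [hsplit, RingTheory.Sequence.isWeaklyRegular_append_iff] at hf
    obtain ⟨hg1, hg2⟩ := hf
    have hgf : Ideal.span (Set.range g) ≤ Ideal.span (Set.range f) := by
      apply Ideal.span_mono
      rintro _ ⟨i, rfl⟩
      exact ⟨i.castSucc, rfl⟩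
    have hreg : ∀ y : Q, f (Fin.last c) * y ∈ Ideal.span (Set.range g) →
        y ∈ Ideal.span (Set.range g) := by
      intro y hy
      rw [RingTheory.Sequence.isWeaklyRegular_singleton_iff] at hg2
      have h0 : (Submodule.Quotient.mk y :
          Q ⧸ (Ideal.ofList (List.ofFn g) • ⊤ : Submodule Q Q)) = 0 := by
        apply hg2.right_eq_zero_of_smul
        rw [← Submodule.Quotient.mk_smul, Submodule.Quotient.mk_eq_zero, ofList_ofFn]
        simpa using hy
      rw [Submodule.Quotient.mk_eq_zero, ofList_ofFn] at h0
      simpa using h0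
    rw [Fin.sum_univ_castSucc] at hx
    have hlast : x (Fin.last c) ∈ Ideal.span (Set.range g) := by
      apply hreg
      rw [eq_neg_of_add_eq_zero_right hx]
      exact neg_mem (Ideal.sum_mem _ fun i _ =>
        Ideal.mul_mem_right _ _ (Ideal.subset_span ⟨i, rfl⟩))
    obtain ⟨y, hy⟩ := (Ideal.mem_span_range_iff_exists_fun).1 hlast
    have key := ih g hg1 (fun i => x i.castSucc + f (Fin.last c) * y i) (by
      rw [← hx, ← hy, Finset.mul_sum, ← Finset.sum_add_distrib]
      refine Finset.sum_congr rfl fun i _ => ?_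
      simp only [hg]; ring)
    intro k
    refine Fin.lastCases (hgf hlast) (fun i => ?_) k
    have h1 := hgf (key i)
    have h2 : f (Fin.last c) * y i ∈ Ideal.span (Set.range f) :=
      Ideal.mul_mem_right _ _ (Ideal.subset_span ⟨_, rfl⟩)
    simpa using sub_mem h1 h2

section Residue

variable {Q : Type u} [CommRing Q] [IsLocalRing Q] {c : ℕ} (f : Fin c → Q)
  [hf : Fact (RingTheory.Sequence.IsRegular Q (List.ofFn f))]

/-- The residue field of `Q` as an algebra over `R = Q/(f₁, …, f_c)`, through the surjection
`R → Q/m`. -/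
instance residueAlgebra : Algebra (QuotRing f) (IsLocalRing.ResidueField Q) :=
  (Ideal.Quotient.lift (Ideal.span (Set.range f)) (IsLocalRing.residue Q) (fun a ha => by
    rw [IsLocalRing.residue_eq_zero_iff]
    exact IsLocalRing.le_maximalIdeal (span_ne_top f hf.out) ha)).toAlgebra

end Residue

/-! ## Lifts to `Q` and Eisenbud operators -/

/-- A lift to `Q` of a complex `C` of finitely generated free modules over `R = Q/(f₁, …, f_c)`.
Each `C^n` is given a finite basis and `d` lifts the matrices of the differentials of `C` to
matrices over `Q`, that is, to `Q`-linear maps `d̃` of free `Q`-modules with `d̃ ⊗_Q R = d`; the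
lift comes with a decomposition `d̃ ∘ d̃ = ∑ f_k t̃_k`. -/
structure Lift {Q : Type u} [CommRing Q] {c : ℕ} (f : Fin c → Q)
    (C : CochainComplex (ModuleCat.{u} (QuotRing f)) ℤ) where
  /-- the rank of each module of the complex -/
  rank : ℤ → ℕ
  /-- a basis of each module of the complex -/
  basis : ∀ n, Module.Basis (Fin (rank n)) (QuotRing f) (C.X n)
  /-- the lifted differentials -/
  d : ∀ m n : ℤ, Matrix (Fin (rank n)) (Fin (rank m)) Q
  map_d : ∀ m n : ℤ, (d m n).map (Ideal.Quotient.mk (Ideal.span (Set.range f))) =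
    LinearMap.toMatrix (basis m) (basis n) (C.d m n).hom
  /-- the maps `t̃_k` -/
  t : Fin c → ∀ m n : ℤ, Matrix (Fin (rank n)) (Fin (rank m)) Q
  d_mul_d : ∀ n : ℤ, d (n + 1) (n + 2) * d n (n + 1) = ∑ k, f k • t k n (n + 2)

namespace Lift

variable {Q : Type u} [CommRing Q] {c : ℕ} {f : Fin c → Q}

/-- Reduction of matrices modulo `(f₁, …, f_c)`. -/
abbrev red (f : Fin c → Q) {m n : Type} (A : Matrix m n Q) : Matrix m n (QuotRing f) :=
  A.map (Ideal.Quotient.mk (Ideal.span (Set.range f)))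

theorem red_mul {l m n : Type} [Fintype m] (A : Matrix l m Q) (B : Matrix m n Q) :
    red f (A * B) = red f A * red f B :=
  Matrix.map_mul

theorem exists_red {m n : Type} (B : Matrix m n (QuotRing f)) : ∃ A : Matrix m n Q, red f A = B := by
  choose A hA using fun i j => Ideal.Quotient.mk_surjective (B i j)
  exact ⟨A, by ext i j; exact hA i j⟩

/-- A matrix that vanishes modulo `(f₁, …, f_c)` is a combination of the `f_k`. -/
theorem exists_sum_of_red_eq_zero {m n : Type} (A : Matrix m n Q) (hA : red f A = 0) :
    ∃ T : Fin c → Matrix m n Q, A = ∑ k, f k • T k := by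
  have h : ∀ i j, ∃ y : Fin c → Q, ∑ k, y k * f k = A i j := fun i j => by
    have := congrFun (congrFun hA i) j
    simp only [Matrix.map_apply, Matrix.zero_apply] at this
    exact Ideal.mem_span_range_iff_exists_fun.1 (Ideal.Quotient.eq_zero_iff_mem.1 this)
  choose y hy using h
  refine ⟨fun k i j => y i j k, ?_⟩
  ext i j
  rw [Matrix.sum_apply, ← hy]
  exact Finset.sum_congr rfl fun k _ => mul_comm _ _

/-- For a regular sequence, `∑ f_k A_k = ∑ f_k B_k` implies that `A_k` and `B_k` agree
modulo `(f₁, …, f_c)`. -/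
theorem red_eq_of_sum_eq (hf : RingTheory.Sequence.IsWeaklyRegular Q (List.ofFn f))
    {m n : Type} (A B : Fin c → Matrix m n Q) (h : ∑ k, f k • A k = ∑ k, f k • B k) (k : Fin c) :
    red f (A k) = red f (B k) := by
  ext i j
  simp only [Matrix.map_apply]
  rw [Ideal.Quotient.mk_eq_mk_iff_sub_mem]
  refine mem_span_of_sum_eq_zero f hf (fun k => A k i j - B k i j) ?_ k
  have := congrFun (congrFun h i) j
  simp only [Matrix.sum_apply, Matrix.smul_apply, smul_eq_mul] at this
  simp only [mul_sub, Finset.sum_sub_distrib, this, sub_self]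

variable {C D : CochainComplex (ModuleCat.{u} (QuotRing f)) ℤ}

theorem red_d (L : Lift f C) (m n : ℤ) :
    red f (L.d m n) = LinearMap.toMatrix (L.basis m) (L.basis n) (C.d m n).hom :=
  L.map_d m n

/-- Every complex of finitely generated free `R`-modules has a lift. -/
theorem nonempty (hfree : ∀ n, Module.Free (QuotRing f) (C.X n))
    (hfin : ∀ n, Module.Finite (QuotRing f) (C.X n)) : Nonempty (Lift f C) := by
  have hb : ∀ n, ∃ r : ℕ, Nonempty (Module.Basis (Fin r) (QuotRing f) (C.X n)) := fun n => by
    have := hfree n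
    have := hfin n
    exact ⟨_, ⟨(Module.Free.chooseBasis (QuotRing f) (C.X n)).reindex (Fintype.equivFin _)⟩⟩
  choose r b using hb
  let b' := fun n => (b n).some
  choose d hd using fun m n : ℤ =>
    exists_red (LinearMap.toMatrix (b' m) (b' n) (C.d m n).hom)
  have ht : ∀ n : ℤ, ∃ T : Fin c → Matrix (Fin (r (n + 2))) (Fin (r n)) Q,
      d (n + 1) (n + 2) * d n (n + 1) = ∑ k, f k • T k := fun n => by
    apply exists_sum_of_red_eq_zero
    rw [red_mul, hd, hd, ← LinearMap.toMatrix_comp, ← ModuleCat.hom_comp, C.d_comp_d]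
    simp
  choose T hT using ht
  exact ⟨⟨r, b', d, hd, fun k m n => if h : n = m + 2 then h ▸ T m k else 0,
    fun n => by rw [hT]; simp⟩⟩

/-- The `R`-linear map `t̃_k ⊗_Q R : C^m → C^n`, of interest when `n = m + 2`. -/
def op (L : Lift f C) (k : Fin c) (m n : ℤ) : C.X m →ₗ[QuotRing f] C.X n :=
  Matrix.toLin (L.basis m) (L.basis n) (red f (L.t k m n))

/-- A family of maps of degree `e` that commutes with the differentials commutes with the maps
`t̃_k ⊗_Q R` up to homotopy. -/
theorem op_comm (hf : RingTheory.Sequence.IsWeaklyRegular Q (List.ofFn f))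
    (L : Lift f C) (L' : Lift f D) (e : ℤ) (ψ : ∀ p q : ℤ, C.X p →ₗ[QuotRing f] D.X q)
    (hψ : ∀ p q : ℤ, p + e = q →
      (D.d q (q + 1)).hom ∘ₗ ψ p q = ψ (p + 1) (q + 1) ∘ₗ (C.d p (p + 1)).hom) (k : Fin c) :
    ∃ τ : ∀ p q : ℤ, C.X p →ₗ[QuotRing f] D.X q, ∀ p q : ℤ, p + e = q →
      ψ (p + 2) (q + 2) ∘ₗ L.op k p (p + 2) - L'.op k q (q + 2) ∘ₗ ψ p q =
        τ (p + 1) (q + 2) ∘ₗ (C.d p (p + 1)).hom +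
          (D.d (q + 1) (q + 2)).hom ∘ₗ τ p (q + 1) := by
  choose Ψ hΨ using fun p q : ℤ =>
    exists_red (LinearMap.toMatrix (L.basis p) (L'.basis q) (ψ p q))
  have hex : ∀ p q : ℤ, ∃ T : Fin c → Matrix (Fin (L'.rank q)) (Fin (L.rank p)) Q,
      ∀ s : ℤ, s + 1 = q → p + e = s →
        Ψ (p + 1) q * L.d p (p + 1) - L'.d s q * Ψ p s = ∑ k, f k • T k := fun p q => by
    by_cases h : p + e + 1 = q
    · subst h
      obtain ⟨T, hT⟩ := exists_sum_of_red_eq_zero (f := f)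
        (Ψ (p + 1) (p + e + 1) * L.d p (p + 1) -
          L'.d (p + e) (p + e + 1) * Ψ p (p + e)) (by
        rw [red, Matrix.map_sub _ (by simp), ← red, ← red, red_mul, red_mul, hΨ, hΨ, L.red_d,
          L'.red_d, ← LinearMap.toMatrix_comp, ← LinearMap.toMatrix_comp, hψ p _ rfl, sub_self])
      refine ⟨T, fun s hs1 hs2 => ?_⟩
      subst hs2
      exact hT
    · exact ⟨0, fun s h1 h2 => absurd (by rw [h2, h1]) h⟩
  choose T hT using hex
  refine ⟨fun p q => Matrix.toLin (L.basis p) (L'.basis q) (red f (T p q k)), ?_⟩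
  rintro p q hpq
  have e1 := hT (p + 1) (q + 2) (q + 1) (by ring) (by rw [← hpq]; ring)
  have e2 := hT p (q + 1) q rfl hpq
  rw [show p + 1 + 1 = p + 2 by ring] at e1
  have hsum : ∑ k, f k • (Ψ (p + 2) (q + 2) * L.t k p (p + 2) - L'.t k q (q + 2) * Ψ p q) =
      ∑ k, f k • (T (p + 1) (q + 2) k * L.d p (p + 1) +
        L'.d (q + 1) (q + 2) * T p (q + 1) k) := by
    have a1 : ∑ k, f k • (Ψ (p + 2) (q + 2) * L.t k p (p + 2)) =
        Ψ (p + 2) (q + 2) * (L.d (p + 1) (p + 2) * L.d p (p + 1)) := by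
      rw [L.d_mul_d, Matrix.mul_sum]
      simp only [Matrix.mul_smul]
    have a2 : ∑ k, f k • (L'.t k q (q + 2) * Ψ p q) =
        (L'.d (q + 1) (q + 2) * L'.d q (q + 1)) * Ψ p q := by
      rw [L'.d_mul_d, Matrix.sum_mul]
      simp only [Matrix.smul_mul]
    have a3 : ∑ k, f k • (T (p + 1) (q + 2) k * L.d p (p + 1)) =
        (Ψ (p + 2) (q + 2) * L.d (p + 1) (p + 2) -
          L'.d (q + 1) (q + 2) * Ψ (p + 1) (q + 1)) * L.d p (p + 1) := by
      rw [e1, Matrix.sum_mul]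
      simp only [Matrix.smul_mul]
    have a4 : ∑ k, f k • (L'.d (q + 1) (q + 2) * T p (q + 1) k) =
        L'.d (q + 1) (q + 2) *
          (Ψ (p + 1) (q + 1) * L.d p (p + 1) - L'.d q (q + 1) * Ψ p q) := by
      rw [e2, Matrix.mul_sum]
      simp only [Matrix.mul_smul]
    simp only [smul_sub, smul_add, Finset.sum_sub_distrib, Finset.sum_add_distrib, a1, a2, a3, a4,
      Matrix.sub_mul, Matrix.mul_sub, Matrix.mul_assoc]
    abel
  have hk := red_eq_of_sum_eq hf _ _ hsum k
  rw [red, Matrix.map_sub _ (by simp), red, Matrix.map_add _ (by simp)] at hk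
  simp only [Matrix.map_mul] at hk
  apply (LinearMap.toMatrix (L.basis p) (L'.basis (q + 2))).injective
  rw [map_sub, map_add, LinearMap.toMatrix_comp _ (L.basis (p + 2)),
    LinearMap.toMatrix_comp _ (L'.basis q), LinearMap.toMatrix_comp _ (L.basis (p + 1)),
    LinearMap.toMatrix_comp _ (L'.basis (q + 1)), ← hΨ, ← hΨ, ← L.red_d, ← L'.red_d]
  simp only [op, LinearMap.toMatrix_toLin]
  exact hk

/-- The maps `t̃_k ⊗_Q R` commute with the differentials of `C`. -/
theorem op_d (hf : RingTheory.Sequence.IsWeaklyRegular Q (List.ofFn f)) (L : Lift f C)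
    (k : Fin c) (p : ℤ) :
    (C.d (p + 2) (p + 3)).hom ∘ₗ L.op k p (p + 2) =
      L.op k (p + 1) (p + 3) ∘ₗ (C.d p (p + 1)).hom := by
  have h1 := L.d_mul_d p
  have h2 := L.d_mul_d (p + 1)
  rw [show p + 1 + 1 = p + 2 by ring, show p + 1 + 2 = p + 3 by ring] at h2
  have hsum : ∑ k, f k • (L.d (p + 2) (p + 3) * L.t k p (p + 2)) =
      ∑ k, f k • (L.t k (p + 1) (p + 3) * L.d p (p + 1)) := by
    have a1 : ∀ k, f k • (L.d (p + 2) (p + 3) * L.t k p (p + 2)) =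
        L.d (p + 2) (p + 3) * (f k • L.t k p (p + 2)) := fun k => (Matrix.mul_smul _ _ _).symm
    have a2 : ∀ k, f k • (L.t k (p + 1) (p + 3) * L.d p (p + 1)) =
        (f k • L.t k (p + 1) (p + 3)) * L.d p (p + 1) := fun k => (Matrix.smul_mul _ _ _).symm
    simp only [a1, a2]
    rw [← Matrix.mul_sum, ← Matrix.sum_mul, ← h1, ← h2, Matrix.mul_assoc]
  have hk := red_eq_of_sum_eq hf _ _ hsum k
  rw [red_mul, red_mul] at hk
  apply (LinearMap.toMatrix (L.basis p) (L.basis (p + 3))).injective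
  rw [LinearMap.toMatrix_comp _ (L.basis (p + 2)), LinearMap.toMatrix_comp _ (L.basis (p + 1)),
    ← L.red_d, ← L.red_d]
  simp only [op, LinearMap.toMatrix_toLin]
  exact hk

/-- The chain map `t_k : C → Σ² C` with components `t̃_k ⊗_Q R`. -/
def chainMap (hf : RingTheory.Sequence.IsWeaklyRegular Q (List.ofFn f)) (L : Lift f C)
    (k : Fin c) : C ⟶ C⟦(2 : ℤ)⟧ where
  f n := ModuleCat.ofHom (L.op k n (n + 2))
  comm' := by
    rintro i j (rfl : i + 1 = j)
    rw [CochainComplex.shiftFunctor_obj_d', Int.negOnePow_even _ (by decide), one_smul]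
    apply ModuleCat.hom_ext
    have := op_d hf L k i
    rw [show i + 3 = i + 1 + 2 by ring] at this
    exact this

theorem op_XIsoOfEq (L : Lift f C) (k : Fin c) (p : ℤ) {q r : ℤ} (h : q = r) :
    ModuleCat.ofHom (L.op k p q) ≫ (C.XIsoOfEq h).hom = ModuleCat.ofHom (L.op k p r) := by
  subst h
  simp

theorem comp_f (hf : RingTheory.Sequence.IsWeaklyRegular Q (List.ofFn f)) (L : Lift f C)
    (j k : Fin c) (p : ℤ) :
    ((ShiftedHom.comp (M := ℤ) (a := 2) (b := 2) (L.chainMap hf j) (L.chainMap hf k)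
      (show (2 : ℤ) + 2 = 4 by norm_num)).f p).hom =
        L.op k (p + 2) (p + 4) ∘ₗ L.op j p (p + 2) := by
  unfold ShiftedHom.comp
  rw [HomologicalComplex.comp_f, HomologicalComplex.comp_f,
    CochainComplex.shiftFunctorAdd'_inv_app_f', CochainComplex.shiftFunctor_map_f']
  have h := L.op_XIsoOfEq k (p + 2) (show p + 2 + 2 = p + 4 by ring)
  exact congrArg (fun z => (ModuleCat.ofHom (L.op j p (p + 2)) ≫ z).hom) h

/-- The homotopy class of `t_k : C → Σ² C`. -/
def operator (hf : RingTheory.Sequence.IsWeaklyRegular Q (List.ofFn f)) (L : Lift f C)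
    (k : Fin c) : HomShift C C 2 :=
  ShiftedHom.map (M := ℤ) (a := 2) (L.chainMap hf k) (HomotopyCategory.quotient _ _)

/-- The homotopy class of `t_k` does not depend on the lift. -/
theorem operator_unique (hf : RingTheory.Sequence.IsWeaklyRegular Q (List.ofFn f))
    (L L' : Lift f C) (k : Fin c) : L.operator hf k = L'.operator hf k := by
  have key : (HomotopyCategory.quotient _ _).map (L.chainMap hf k) =
      (HomotopyCategory.quotient _ _).map (L'.chainMap hf k) := by
    obtain ⟨τ, hτ⟩ := op_comm hf L L' 0
      (fun p q => if h : p = q then (by rw [h]; exact LinearMap.id) else 0)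
      (by rintro p q hpq; obtain rfl : p = q := by omega
          simp) k
    refine quotient_map_eq (by decide) _ _ τ fun p => ?_
    have := hτ p p (by ring)
    rw [show p - 1 + 2 = p + 1 by ring]
    simp only [dif_pos] at this
    exact this
  exact congrArg (fun z => z ≫ ((HomotopyCategory.quotient _ _).commShiftIso (2 : ℤ)).hom.app C) key

/-- The operators `t_j` and `t_k` commute up to homotopy. -/
theorem operator_comm (hf : RingTheory.Sequence.IsWeaklyRegular Q (List.ofFn f))
    (L : Lift f C) (j k : Fin c) :
    (L.operator hf j).comp (L.operator hf k) (show (2 : ℤ) + 2 = 4 by norm_num) =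
      (L.operator hf k).comp (L.operator hf j) (show (2 : ℤ) + 2 = 4 by norm_num) := by
  let tj : ShiftedHom C C (2 : ℤ) := L.chainMap hf j
  let tk : ShiftedHom C C (2 : ℤ) := L.chainMap hf k
  have key : (HomotopyCategory.quotient _ _).map (tj.comp tk (show (2 : ℤ) + 2 = 4 by norm_num)) =
      (HomotopyCategory.quotient _ _).map (tk.comp tj (show (2 : ℤ) + 2 = 4 by norm_num)) := by
    obtain ⟨τ, hτ⟩ := op_comm hf L L 2 (fun p q => L.op k p q)
      (by rintro p q rfl
          have := op_d hf L k p
          rw [show p + 2 + 1 = p + 3 by ring]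
          exact this) j
    refine quotient_map_eq (by decide) _ _ τ fun p => ?_
    have := hτ p (p + 2) rfl
    rw [show p + 2 + 1 = p + 3 by ring, show p + 2 + 2 = p + 4 by ring] at this
    rw [show p - 1 + 4 = p + 3 by ring, ← this, comp_f, comp_f]
    abel
  rw [operator, operator, ← ShiftedHom.map_comp, ← ShiftedHom.map_comp]
  exact congrArg (fun z => z ≫ ((HomotopyCategory.quotient _ _).commShiftIso (4 : ℤ)).hom.app C) key

end Lift

/-! ## The module of cohomology operators -/

section Operators

variable {Q : Type u} [CommRing Q] {c : ℕ} (f : Fin c → Q)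
  [hf : Fact (RingTheory.Sequence.IsRegular Q (List.ofFn f))]

/-- The Eisenbud operator `t_k : C → Σ² C` of a totally acyclic complex, as a morphism of the
homotopy category. It is the class of `t̃_k ⊗_Q R` for any lift of `C` to `Q`. -/
def eisenbud (C : Ktac (QuotRing f)) (k : Fin c) : HomShift C.X C.X 2 :=
  (Lift.nonempty (f := f) C.free C.finite).some.operator hf.out.toIsWeaklyRegular k

/-- Every lift of `C` computes the Eisenbud operators. -/
theorem eisenbud_eq (C : Ktac (QuotRing f)) (L : Lift f C.X) (k : Fin c) :
    eisenbud f C k = L.operator hf.out.toIsWeaklyRegular k :=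
  Lift.operator_unique _ _ _ _

theorem eisenbud_comm (C : Ktac (QuotRing f)) (j k : Fin c) :
    (eisenbud f C j).comp (eisenbud f C k) (show (2 : ℤ) + 2 = 4 by norm_num) =
      (eisenbud f C k).comp (eisenbud f C j) (show (2 : ℤ) + 2 = 4 by norm_num) :=
  Lift.operator_comm _ _ _ _

variable (C D : Ktac (QuotRing f))

/-- The `R`-module `⨁_{i ≥ 0} Hom_R(C, Σ^i D)`. -/
abbrev HomSum : Type u := DirectSum ℕ fun i => HomShift C.X D.X (i : ℤ)

/-- The cohomology operator `Hom_R(C, Σ^i D) → Hom_R(C, Σ^(i+2) D)`, composition with `t_k`. -/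
def chiDeg (k : Fin c) (i : ℕ) :
    HomShift C.X D.X (i : ℤ) →ₗ[QuotRing f] HomShift C.X D.X ((i + 2 : ℕ) : ℤ) where
  toFun α := (eisenbud f C k).comp α (by push_cast; rfl)
  map_add' α β := ShiftedHom.comp_add _ _ _ _
  map_smul' r α := ShiftedHom.comp_smul _ _ _ _

/-- The action of `χ_k` on `⨁_{i ≥ 0} Hom_R(C, Σ^i D)`. -/
def chi (k : Fin c) : Module.End (QuotRing f) (HomSum f C D) :=
  DirectSum.toModule _ _ _ fun i =>
    DirectSum.lof (QuotRing f) ℕ (fun i => HomShift C.X D.X (i : ℤ)) (i + 2) ∘ₗ chiDeg f C D k i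

theorem chi_lof (k : Fin c) (i : ℕ) (α : HomShift C.X D.X (i : ℤ)) :
    chi f C D k (DirectSum.lof (QuotRing f) ℕ (fun i => HomShift C.X D.X (i : ℤ)) i α) =
      DirectSum.lof (QuotRing f) ℕ (fun i => HomShift C.X D.X (i : ℤ)) (i + 2)
        (chiDeg f C D k i α) := by
  simp [chi, DirectSum.toModule_lof]

theorem chi_comm (j k : Fin c) : Commute (chi f C D j) (chi f C D k) := by
  apply DirectSum.linearMap_ext
  intro i
  ext α
  have h : chiDeg f C D j (i + 2) (chiDeg f C D k i α) =
      chiDeg f C D k (i + 2) (chiDeg f C D j i α) := by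
    have h1 := ShiftedHom.comp_assoc (eisenbud f C j) (eisenbud f C k) α
      (show (2 : ℤ) + 2 = 4 by norm_num) (show (i : ℤ) + 2 = ((i + 2 : ℕ) : ℤ) by push_cast; rfl)
      (show (i : ℤ) + 2 + 2 = ((i + 2 + 2 : ℕ) : ℤ) by push_cast; rfl)
    have h2 := ShiftedHom.comp_assoc (eisenbud f C k) (eisenbud f C j) α
      (show (2 : ℤ) + 2 = 4 by norm_num) (show (i : ℤ) + 2 = ((i + 2 : ℕ) : ℤ) by push_cast; rfl)
      (show (i : ℤ) + 2 + 2 = ((i + 2 + 2 : ℕ) : ℤ) by push_cast; rfl)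
    rw [eisenbud_comm] at h1
    exact h1.symm.trans h2
  simp only [LinearMap.comp_apply, Module.End.mul_apply, chi_lof, h]

end Operators

open scoped IsMulCommutative in
/-- The evaluation of polynomials at a family of commuting elements of an algebra. -/
def evalCommuting {K A : Type u} [CommRing K] [Ring A] [Algebra K A] {c : ℕ} (x : Fin c → A)
    (hx : ∀ i j, Commute (x i) (x j)) : MvPolynomial (Fin c) K →ₐ[K] A :=
  haveI := Algebra.isMulCommutative_adjoin K (s := Set.range x)
    (by rintro _ ⟨i, rfl⟩ _ ⟨j, rfl⟩; exact hx i j)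
  (Algebra.adjoin K (Set.range x)).val.comp
    (MvPolynomial.aeval fun i => ⟨x i, Algebra.subset_adjoin ⟨i, rfl⟩⟩)

theorem evalCommuting_X {K A : Type u} [CommRing K] [Ring A] [Algebra K A] {c : ℕ} (x : Fin c → A)
    (hx : ∀ i j, Commute (x i) (x j)) (i : Fin c) :
    evalCommuting (K := K) x hx (MvPolynomial.X i) = x i := by
  simp [evalCommuting]

/-! ## Support varieties -/

section Support

variable {Q : Type u} [CommRing Q] {c : ℕ} (f : Fin c → Q)
  [hf : Fact (RingTheory.Sequence.IsRegular Q (List.ofFn f))]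

variable [IsLocalRing Q] (C D : Ktac (QuotRing f))

/-- `E = k ⊗_R ⨁_{i ≥ 0} Hom_R(C, Σ^i D)`. -/
abbrev SupportModule : Type u :=
  TensorProduct (QuotRing f) (IsLocalRing.ResidueField Q) (HomSum f C D)

/-- The action of `k[χ₁, …, χ_c]` on `E`, in which `χ_j` acts as `id ⊗ χ_j`. -/
def supportAction : MvPolynomial (Fin c) (IsLocalRing.ResidueField Q) →ₐ[IsLocalRing.ResidueField Q]
    Module.End (IsLocalRing.ResidueField Q) (SupportModule f C D) :=
  evalCommuting (fun j => Module.End.baseChangeHom (QuotRing f) (IsLocalRing.ResidueField Q)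
      (HomSum f C D) (chi f C D j)) fun i j =>
    (chi_comm f C D i j).map (Module.End.baseChangeHom (QuotRing f) (IsLocalRing.ResidueField Q)
      (HomSum f C D))

theorem supportAction_X_tmul (j : Fin c) (a : IsLocalRing.ResidueField Q) (h : HomSum f C D) :
    supportAction f C D (MvPolynomial.X j) (TensorProduct.tmul _ a h) =
      TensorProduct.tmul _ a (chi f C D j h) := by
  rw [supportAction, evalCommuting_X]
  rfl

/-- The support variety `V(Q, f, C, D) ⊆ k^c`: the zero set of the annihilator of the
`k[χ₁, …, χ_c]`-module `E`, together with the origin. -/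
def supportVariety : Set (Fin c → IsLocalRing.ResidueField Q) :=
  {b | ∀ φ : MvPolynomial (Fin c) (IsLocalRing.ResidueField Q),
    (∀ e : SupportModule f C D, supportAction f C D φ e = 0) → MvPolynomial.eval b φ = 0} ∪ {0}

end Support

end TotallyAcyclic

end

/-! If `Hom_R(C, Σ^i D)` vanishes for large `i`, then a high power of each `χ_j`, which raises
degrees by two, kills `E`, so only the origin lies in the variety. Conversely, if the variety is the
origin, the Nullstellensatz puts `(χ_1, …, χ_c)^s` into the annihilator of `E` for some `s`
(`exists_pow_le_ker`). Once every `Hom_R(C, Σ^(i+2) D)` with `i ≥ n` is the sum of the images of the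
`χ_k`, everything in degrees at least `n + 2s` lies in `(χ)^s E = 0`. Each `Hom_R(C, Σ^i D)` is
finitely generated, so Nakayama's lemma finishes.

The substance is thus finite generation over the operators (`exists_eq_sum_chiDeg`). Lifting `C` to
`Q` gives a "curved complex": free `Q`-modules with `d² = ∑ f_k t_k`. Maps from it to `D`, which is
killed by the `f_k`, compute `Hom_R(C, Σ^i D)`, with `χ_k` being composition with `t_k`.
`CurvedComplex.eventuallyGenerated` is then an induction on `c`. The cone of `t_c` lifts to a curved
complex over `f_1, …, f_(c-1)`, still exact modulo these elements. The kernel of the map from the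
cohomology of `X` to that of the cone is the image of `χ_c`, and the map commutes with the other
operators. Its image is eventually generated by Hilbert's basis theorem, and `χ_c` supplies the
kernel.

For `c = 0` one has an honest exact complex of finitely generated free modules over a regular local
ring. Since the maximal ideal is generated by a regular sequence, the complex stays exact over the
residue field. There it splits, and Nakayama lifts the splitting, so the complex is contractible and
its cohomology vanishes.

Finiteness in a single degree comes from total acyclicity: a cocycle with one zero component is
null-homotopic, because the homotopy extends to one side by exactness of the dual of `C` and to the
other by exactness of `D`. Hence the cohomology is a subquotient of `Hom_Q(M^0, D^i)`. -/

/-! ### Regular local rings: domains whose maximal ideal is generated by a regular sequence. -/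

open IsLocalRing in
/-- In a local ring, a generating finite set of an ideal `I ≤ m` can be exchanged for one that
contains a given element of `I` outside `m * I`. -/
theorem IsLocalRing.exists_insert_erase_span {Q : Type*} [CommRing Q] [IsLocalRing Q]
    [DecidableEq Q] {I : Ideal Q} {s : Finset Q} (hs : Ideal.span (s : Set Q) = I) {x : Q}
    (hx : x ∈ I) (hx' : x ∉ maximalIdeal Q * I) :
    ∃ y ∈ s, I ≤ Ideal.span (s.erase y : Set Q) ⊔ Ideal.span {x} := by
  classical
  rw [← hs] at hx
  obtain ⟨a, ha⟩ := Submodule.mem_span_finset'.1 hx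
  -- If every coefficient were a nonunit, `x` would lie in `m * I`.
  obtain ⟨y, hy⟩ : ∃ y : s, IsUnit (a y) := by
    by_contra! h
    apply hx'
    rw [← ha]
    exact Ideal.sum_mem _ fun y _ => Ideal.mul_mem_mul ((mem_maximalIdeal _).2 (h y))
      (hs ▸ Ideal.subset_span y.2)
  refine ⟨y, y.2, ?_⟩
  rw [← hs, Ideal.span_le]
  intro z hz
  by_cases hzy : z = y
  · subst hzy
    rw [← Finset.add_sum_erase _ _ (Finset.mem_univ y)] at ha
    have h2 : a y • (y : Q) = x - ∑ i ∈ Finset.univ.erase y, a i • (i : Q) := by rw [← ha]; ring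
    have h3 : a y * (y : Q) ∈ Ideal.span (s.erase y : Set Q) ⊔ Ideal.span {x} := by
      rw [← smul_eq_mul, h2]
      refine sub_mem (Ideal.mem_sup_right (Ideal.mem_span_singleton_self x))
        (Ideal.mem_sup_left (Ideal.sum_mem _ fun i hi => Ideal.mul_mem_left _ _
          (Ideal.subset_span ?_)))
      simp only [Finset.coe_erase, Set.mem_sdiff, Finset.mem_coe, Set.mem_singleton_iff]
      exact ⟨i.2, fun h => (Finset.mem_erase.1 hi).1 (Subtype.ext h)⟩
    exact (Ideal.unit_mul_mem_iff_mem _ hy).1 h3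
  · exact Ideal.mem_sup_left (Ideal.subset_span (by simpa [hzy] using hz))

namespace IsRegularLocalRing

open IsLocalRing

variable {Q : Type*} [CommRing Q] [IsRegularLocalRing Q]

theorem map_mk_maximalIdeal {R : Type*} [CommRing R] [IsLocalRing R] (I : Ideal R)
    [IsLocalRing (R ⧸ I)] : (maximalIdeal R).map (Ideal.Quotient.mk I) = maximalIdeal (R ⧸ I) := by
  have h : (maximalIdeal (R ⧸ I)).comap (Ideal.Quotient.mk I) = maximalIdeal R :=
    IsLocalRing.eq_maximalIdeal
      (Ideal.comap_isMaximal_of_surjective _ Ideal.Quotient.mk_surjective)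
  rw [← h, Ideal.map_comap_of_surjective _ Ideal.Quotient.mk_surjective]

theorem nontrivial_quotient_span_singleton {R : Type*} [CommRing R] [IsLocalRing R] {x : R}
    (hx : x ∈ maximalIdeal R) : Nontrivial (R ⧸ Ideal.span {x}) :=
  Ideal.Quotient.nontrivial_iff.2 fun h => (mem_maximalIdeal _).1 hx
    (Ideal.span_singleton_eq_top.1 h)

open scoped Pointwise in
/-- The quotient of a regular local ring by an element of `m` outside `m²` is regular, and its
maximal ideal needs one generator less. -/
theorem quotient_span_singleton {x : Q} (hx : x ∈ maximalIdeal Q)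
    (hx' : x ∉ maximalIdeal Q * maximalIdeal Q) :
    ∃ _ : IsRegularLocalRing (Q ⧸ Ideal.span {x}),
      (maximalIdeal (Q ⧸ Ideal.span {x})).spanFinrank + 1 = (maximalIdeal Q).spanFinrank := by
  classical
  have := nontrivial_quotient_span_singleton hx
  have hloc : IsLocalRing (Q ⧸ Ideal.span {x}) :=
    .of_surjective' _ Ideal.Quotient.mk_surjective
  obtain ⟨s, hcard, hs⟩ :=
    Submodule.FG.exists_span_finset_card_eq_spanFinrank (maximalIdeal Q).fg_of_isNoetherianRing
  obtain ⟨y, hy, hle⟩ := exists_insert_erase_span hs hx hx'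
  have hspan : maximalIdeal (Q ⧸ Ideal.span {x}) =
      Ideal.span (((s.erase y).image (Ideal.Quotient.mk (Ideal.span {x})) : Finset _) : Set _) := by
    apply le_antisymm
    · rw [← map_mk_maximalIdeal]
      refine (Ideal.map_mono hle).trans ?_
      rw [Ideal.map_sup, Ideal.map_span, Ideal.map_span, Finset.coe_image]
      simp
    · rw [← map_mk_maximalIdeal, Finset.coe_image, ← Ideal.map_span]
      apply Ideal.map_mono
      rw [← hs]
      exact Ideal.span_mono (by simp)
  have h1 : (maximalIdeal (Q ⧸ Ideal.span {x})).spanFinrank + 1 ≤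
      (maximalIdeal Q).spanFinrank := by
    have h2 := Submodule.spanFinrank_span_le_ncard_of_finite (R := Q ⧸ Ideal.span {x})
      (Finset.finite_toSet ((s.erase y).image (Ideal.Quotient.mk (Ideal.span {x}))))
    rw [← Ideal.span, ← hspan, Set.ncard_coe_finset] at h2
    have h3 : ((s.erase y).image (Ideal.Quotient.mk (Ideal.span {x}))).card ≤ (s.erase y).card :=
      Finset.card_image_le
    have h4 := Finset.card_erase_add_one hy
    omega
  -- The dimension drops by at most one, while the number of generators of the maximal ideal drops
  -- by at least one. Equality of the two numbers for `Q`, and dimension ≤ number of generators for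
  -- the quotient, squeeze both drops to exactly one.
  have h2 : ringKrullDim Q ≤ ringKrullDim (Q ⧸ Ideal.span {x}) + 1 := by
    have := ringKrullDim_le_ringKrullDim_quotSMulTop_succ hx
    have h : Ideal.span {x} = x • (⊤ : Ideal Q) := by
      simp [← Submodule.ideal_span_singleton_smul]
    rwa [ringKrullDim_eq_of_ringEquiv (Ideal.quotientEquivAlgOfEq Q h).toRingEquiv]
  rw [← IsRegularLocalRing.spanFinrank_maximalIdeal] at h2
  have h3 := ringKrullDim_le_spanFinrank_maximalIdeal (Q ⧸ Ideal.span {x})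
  have h4 : (maximalIdeal Q).spanFinrank ≤
      (maximalIdeal (Q ⧸ Ideal.span {x})).spanFinrank + 1 := by
    have := h2.trans (add_le_add_left h3 1)
    exact_mod_cast this
  have h5 := le_antisymm h1 h4
  refine ⟨of_spanFinrank_maximalIdeal_le _ ?_, h5⟩
  rw [← h5] at h2
  push_cast at h2
  generalize ringKrullDim (Q ⧸ Ideal.span {x}) = e at h2 ⊢
  generalize (maximalIdeal (Q ⧸ Ideal.span {x})).spanFinrank = n at h2 ⊢
  induction e using WithBot.recBotCoe with
  | bot => exact absurd h2 (by rw [WithBot.bot_add, le_bot_iff]; exact_mod_cast WithBot.coe_ne_bot)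
  | coe e =>
    have h2' : (n : ℕ∞) + 1 ≤ e + 1 := by exact_mod_cast h2
    exact_mod_cast (ENat.add_le_add_iff_right (by simp)).1 h2'

/-- A regular local ring that is not a field has an element of `m` outside `m²` and outside all
minimal primes. -/
theorem exists_mem_maximalIdeal (h : (maximalIdeal Q).spanFinrank ≠ 0) :
    ∃ x ∈ maximalIdeal Q, x ∉ maximalIdeal Q * maximalIdeal Q ∧
      ∀ P ∈ minimalPrimes Q, x ∉ P := by
  by_contra! hcon
  have hfin : (minimalPrimes Q).Finite := minimalPrimes.finite_of_isNoetherianRing Q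
  have hsub : (maximalIdeal Q : Set Q) ⊆
      ⋃ I ∈ insert (maximalIdeal Q * maximalIdeal Q) (minimalPrimes Q), ((id I : Ideal Q) : Set Q) := by
    intro x hx
    by_cases hx' : x ∈ maximalIdeal Q * maximalIdeal Q
    · exact Set.mem_biUnion (Set.mem_insert _ _) hx'
    · obtain ⟨P, hP, hxP⟩ := hcon x hx hx'
      exact Set.mem_biUnion (Set.mem_insert_of_mem _ hP) hxP
  -- Prime avoidance tolerates two members of the cover that are not prime; both exceptional places
  -- are given to `m²`.
  rw [Ideal.subset_union_prime_finite (hfin.insert _) (maximalIdeal Q * maximalIdeal Q)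
    (maximalIdeal Q * maximalIdeal Q)] at hsub
  · obtain ⟨I, hI, hle⟩ := hsub
    rcases hI with rfl | hI
    · have h0 : maximalIdeal Q = ⊥ :=
        Submodule.eq_bot_of_le_smul_of_le_jacobson_bot (maximalIdeal Q) _
          (maximalIdeal Q).fg_of_isNoetherianRing hle (by
            rw [IsLocalRing.jacobson_eq_maximalIdeal _ bot_ne_top])
      rw [h0] at h
      simp at h
    · have hprime : I.IsPrime := hI.1.1
      have hIm : I = maximalIdeal Q :=
        le_antisymm (IsLocalRing.le_maximalIdeal hprime.ne_top) hle
      have h0 : (maximalIdeal Q).height = 0 := by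
        rw [← hIm]; exact Ideal.height_eq_zero_iff.2 hI
      have h1 := IsLocalRing.maximalIdeal_height_eq_ringKrullDim (R := Q)
      rw [h0, ← IsRegularLocalRing.spanFinrank_maximalIdeal] at h1
      exact h (by exact_mod_cast h1.symm)
  · rintro I (rfl | hI) h1 _
    · exact absurd rfl h1
    · exact hI.1.1

/-- For `x` in `m` outside `m²` and all minimal primes, `Q/(x)` is regular with one generator less,
so `(x)` is prime by induction. A minimal prime `P ⊆ (x)` does not contain `x`, hence `P = xP`, and
`P = 0` by Nakayama. -/
theorem isDomain_of_spanFinrank_eq (n : ℕ) : ∀ (Q : Type*) [CommRing Q] [IsRegularLocalRing Q],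
    (maximalIdeal Q).spanFinrank = n → IsDomain Q := by
  induction n with
  | zero =>
    intro Q _ _ h
    rw [Submodule.spanFinrank_eq_zero_iff_eq_bot
      (maximalIdeal Q).fg_of_isNoetherianRing] at h
    exact (IsLocalRing.isField_iff_maximalIdeal_eq.2 h).isDomain
  | succ n ih =>
    intro Q _ _ h
    obtain ⟨x, hx, hx', hP⟩ := exists_mem_maximalIdeal (Q := Q) (by omega)
    obtain ⟨_, h2⟩ := quotient_span_singleton hx hx'
    have := ih (Q ⧸ Ideal.span {x}) (by omega)
    have hprime : (Ideal.span {x}).IsPrime := (Ideal.Quotient.isDomain_iff_prime _).1 this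
    obtain ⟨P, hPmin, hPle⟩ := Ideal.exists_minimalPrimes_le (bot_le (a := Ideal.span {x}))
    have hPprime : P.IsPrime := hPmin.1.1
    have hPbot : P = ⊥ := by
      refine Submodule.eq_bot_of_le_smul_of_le_jacobson_bot (maximalIdeal Q) _
        P.fg_of_isNoetherianRing (fun p hp => ?_) (by
          rw [IsLocalRing.jacobson_eq_maximalIdeal _ bot_ne_top])
      obtain ⟨a, rfl⟩ := Ideal.mem_span_singleton.1 (hPle hp)
      exact Submodule.smul_mem_smul hx ((hPprime.mem_or_mem hp).resolve_left (hP P hPmin))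
    rw [hPbot] at hPprime
    exact IsDomain.of_bot_isPrime Q

/-- Regular local rings are domains. -/
theorem isDomain : IsDomain Q :=
  isDomain_of_spanFinrank_eq _ Q rfl

end IsRegularLocalRing

/-- The ideals that are generated by a regular sequence, built one element at a time. -/
inductive Ideal.GeneratedByRegularSequence {Q : Type*} [CommRing Q] : Ideal Q → Prop
  | bot : GeneratedByRegularSequence ⊥
  | sup {J : Ideal Q} {x : Q} : GeneratedByRegularSequence J → (∀ y, x * y ∈ J → y ∈ J) →
      GeneratedByRegularSequence (J ⊔ Ideal.span {x})

/-- The inductive predicate appends elements at the end of the sequence, whereas induction on the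
dimension produces `x` at its beginning. This lemma prepends `x`: the preimage of `J` is generated
by `x` followed by lifts of the generators of `J`. -/
theorem Ideal.GeneratedByRegularSequence.comap_mk {Q : Type*} [CommRing Q] {x : Q}
    (hx : ∀ y, x * y = 0 → y = 0) {J : Ideal (Q ⧸ Ideal.span {x})}
    (hJ : J.GeneratedByRegularSequence) :
    (J.comap (Ideal.Quotient.mk (Ideal.span {x}))).GeneratedByRegularSequence := by
  induction hJ with
  | bot =>
    have := GeneratedByRegularSequence.sup (J := ⊥) (x := x) .bot (by simpa using hx)
    rwa [bot_sup_eq, ← Ideal.mk_ker (I := Ideal.span {x})] at this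
  | @sup J y hJ hy ih =>
    obtain ⟨y, rfl⟩ := Ideal.Quotient.mk_surjective y
    have h := GeneratedByRegularSequence.sup (x := y) ih (by
      intro z hz
      rw [Ideal.mem_comap, map_mul] at hz
      exact hy _ hz)
    convert h using 1
    apply le_antisymm
    · intro z hz
      rw [Ideal.mem_comap, Submodule.mem_sup] at hz
      obtain ⟨a, ha, b, hb, hab⟩ := hz
      obtain ⟨b, rfl⟩ := Ideal.mem_span_singleton'.1 hb
      obtain ⟨b, rfl⟩ := Ideal.Quotient.mk_surjective b
      have : z = (z - b * y) + b * y := by ring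
      rw [this]
      refine add_mem (Ideal.mem_sup_left ?_) (Ideal.mem_sup_right
        (Ideal.mul_mem_left _ _ (Ideal.mem_span_singleton_self y)))
      rw [Ideal.mem_comap, map_sub, map_mul, ← hab]
      simpa using ha
    · refine sup_le (Ideal.comap_mono le_sup_left) ?_
      rw [Ideal.span_singleton_le_iff_mem]
      exact Ideal.mem_sup_right (Ideal.mem_span_singleton_self _)

-- Divide by an element of `m` outside `m²` and induct; it is a nonzerodivisor because `Q` is a
-- domain.
open IsLocalRing in
theorem IsRegularLocalRing.generatedByRegularSequence_of_spanFinrank_eq (n : ℕ) :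
    ∀ (Q : Type*) [CommRing Q] [IsRegularLocalRing Q], (maximalIdeal Q).spanFinrank = n →
      (maximalIdeal Q).GeneratedByRegularSequence := by
  induction n with
  | zero =>
    intro Q _ _ h
    rw [Submodule.spanFinrank_eq_zero_iff_eq_bot
      (maximalIdeal Q).fg_of_isNoetherianRing] at h
    rw [h]
    exact .bot
  | succ n ih =>
    intro Q _ _ h
    obtain ⟨x, hx, hx', -⟩ := exists_mem_maximalIdeal (Q := Q) (by omega)
    obtain ⟨_, h2⟩ := quotient_span_singleton hx hx'
    have := isDomain (Q := Q)
    have hx0 : x ≠ 0 := by rintro rfl; exact hx' (zero_mem _)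
    have h3 := (ih (Q ⧸ Ideal.span {x}) (by omega)).comap_mk
      fun y hy => (mul_eq_zero.1 hy).resolve_left hx0
    rwa [IsLocalRing.eq_maximalIdeal (Ideal.comap_isMaximal_of_surjective
      (Ideal.Quotient.mk (Ideal.span {x})) Ideal.Quotient.mk_surjective
      (K := maximalIdeal (Q ⧸ Ideal.span {x})))] at h3

/-- The maximal ideal of a regular local ring is generated by a regular sequence. -/
theorem IsRegularLocalRing.generatedByRegularSequence_maximalIdeal (Q : Type*) [CommRing Q]
    [IsRegularLocalRing Q] : (IsLocalRing.maximalIdeal Q).GeneratedByRegularSequence :=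
  generatedByRegularSequence_of_spanFinrank_eq _ Q rfl

/-! ### Eventual generation by operators and Hilbert's basis theorem. -/

/-- A family of modules with operators of degree two is *eventually generated* if, in all large
degrees, every element is a combination of values of the operators. -/
def EventuallyGenerated {A : Type u} [CommRing A] {c : ℕ} {H : ℕ → Type u}
    [∀ i, AddCommGroup (H i)] [∀ i, Module A (H i)]
    (χ : Fin c → ∀ i, H i →ₗ[A] H (i + 2)) : Prop :=
  ∃ n, ∀ i, n ≤ i → ∀ x : H (i + 2), ∃ y : Fin c → H i, x = ∑ k, χ k i (y k)

namespace EventuallyGenerated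

variable {A : Type u} [CommRing A] {c : ℕ} {H : ℕ → Type u}
    [∀ i, AddCommGroup (H i)] [∀ i, Module A (H i)]
    (χ : Fin c → ∀ i, H i →ₗ[A] H (i + 2))

/-- The endomorphism of the direct sum given by an operator of degree two. -/
noncomputable def total (k : Fin c) : Module.End A (DirectSum ℕ H) :=
  DirectSum.toModule _ _ _ fun i => DirectSum.lof A ℕ H (i + 2) ∘ₗ χ k i

theorem total_lof (k : Fin c) (i : ℕ) (x : H i) :
    total χ k (DirectSum.lof A ℕ H i x) = DirectSum.lof A ℕ H (i + 2) (χ k i x) := by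
  simp [total, DirectSum.toModule_lof]

theorem total_apply (k : Fin c) (m : DirectSum ℕ H) (i : ℕ) :
    total χ k m (i + 2) = χ k i (m i) := by
  classical
  induction m using DirectSum.induction_on with
  | zero => simp
  | of j x =>
    change total χ k (DirectSum.lof A ℕ H j x) (i + 2) = χ k i (DirectSum.lof A ℕ H j x i)
    rw [total_lof]
    by_cases h : j = i
    · subst h
      rw [DirectSum.lof_apply, DirectSum.lof_apply]
    · rw [DirectSum.lof_eq_of, DirectSum.lof_eq_of, DirectSum.of_eq_of_ne _ _ _ (by omega),
        DirectSum.of_eq_of_ne _ _ _ (by omega), map_zero]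
  | add x y hx hy => rw [map_add, DirectSum.add_apply, hx, hy, DirectSum.add_apply, map_add]

theorem total_apply_zero (k : Fin c) (m : DirectSum ℕ H) (i : ℕ) (hi : i < 2) :
    total χ k m i = 0 := by
  classical
  induction m using DirectSum.induction_on with
  | zero => simp
  | of j x =>
    change total χ k (DirectSum.lof A ℕ H j x) i = 0
    rw [total_lof, DirectSum.lof_eq_of, DirectSum.of_eq_of_ne _ _ _ (by omega)]
  | add x y hx hy => rw [map_add, DirectSum.add_apply, hx, hy, add_zero]

theorem total_comm (comm : ∀ j k i x, χ j (i + 2) (χ k i x) = χ k (i + 2) (χ j i x)) (j k : Fin c) :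
    Commute (total χ j) (total χ k) := by
  apply DirectSum.linearMap_ext
  intro i
  ext x : 1
  simp only [LinearMap.comp_apply, Module.End.mul_apply, total_lof, comm]

/-- By Hilbert's basis theorem, stable families of submodules of an eventually generated family
of finitely generated modules are eventually generated. -/
theorem submodule [IsNoetherianRing A] [∀ i, Module.Finite A (H i)]
    (comm : ∀ j k i x, χ j (i + 2) (χ k i x) = χ k (i + 2) (χ j i x))
    (gen : EventuallyGenerated χ) (P : ∀ i, Submodule A (H i))
    (hP : ∀ k i x, x ∈ P i → χ k i x ∈ P (i + 2)) :
    ∃ n, ∀ i, n ≤ i → ∀ x ∈ P (i + 2), ∃ y : Fin c → H i,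
      (∀ k, y k ∈ P i) ∧ x = ∑ k, χ k i (y k) := by
  classical
  let S := MvPolynomial (Fin c) A
  let ev := TotallyAcyclic.evalCommuting (K := A) (total χ) (total_comm χ comm)
  let _ : Module S (DirectSum ℕ H) := Module.compHom _ ev.toRingHom
  have hX : ∀ (k : Fin c) (m : DirectSum ℕ H),
      (MvPolynomial.X k : S) • m = total χ k m := fun k m => by
    change ev (MvPolynomial.X k) m = _
    rw [TotallyAcyclic.evalCommuting_X]
  have hC : ∀ (a : A) (m : DirectSum ℕ H), (MvPolynomial.C a : S) • m = a • m := fun a m => by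
    change ev (algebraMap A S a) m = _
    rw [AlgHom.commutes]
    rfl
  have : IsScalarTower A S (DirectSum ℕ H) := ⟨fun a s m => by
    rw [← hC, ← mul_smul, MvPolynomial.C_mul']⟩
  obtain ⟨n, hn⟩ := gen
  -- Degrees below `n + 2` generate over the polynomial ring: every higher degree is `j + 2` with `j
  -- ≥ n`, where the operators reach everything.
  let G : Submodule S (DirectSum ℕ H) :=
    ⨆ i : Fin (n + 2), Submodule.span S (LinearMap.range (DirectSum.lof A ℕ H i) : Set _)
  have hGfg : G.FG := by
    refine Submodule.fg_iSup _ fun i => ?_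
    obtain ⟨T, hT⟩ := (Module.Finite.fg_top (R := A) (M := H i))
    refine ⟨T.image (DirectSum.lof A ℕ H i), le_antisymm (Submodule.span_mono ?_) ?_⟩
    · intro x hx
      simp only [Finset.coe_image, Set.mem_image] at hx
      obtain ⟨y, -, rfl⟩ := hx
      exact ⟨y, rfl⟩
    · rw [Submodule.span_le]
      rintro _ ⟨y, rfl⟩
      have hy : y ∈ Submodule.span A (T : Set (H i)) := hT ▸ Submodule.mem_top
      have := Submodule.mem_map_of_mem (f := DirectSum.lof A ℕ H i) hy
      rw [Submodule.map_span] at this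
      have h2 := Submodule.span_le_restrictScalars A S _ this
      simpa using h2
  have hmem : ∀ i (x : H i), DirectSum.lof A ℕ H i x ∈ G := by
    intro i
    induction i using Nat.strong_induction_on with
    | _ i ih =>
      intro x
      by_cases hi : i < n + 2
      · exact Submodule.mem_iSup_of_mem (⟨i, hi⟩ : Fin (n + 2)) (Submodule.subset_span ⟨x, rfl⟩)
      · obtain ⟨j, rfl⟩ : ∃ j, i = j + 2 := ⟨i - 2, by omega⟩
        obtain ⟨y, rfl⟩ := hn j (by omega) x
        rw [map_sum]
        refine Submodule.sum_mem _ fun k _ => ?_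
        rw [← total_lof, ← hX]
        exact G.smul_mem _ (ih j (by omega) (y k))
  have hGtop : G = ⊤ := by
    rw [eq_top_iff]
    intro m _
    induction m using DirectSum.induction_on with
    | zero => exact zero_mem _
    | of i x => exact hmem i x
    | add x y hx hy => exact add_mem (hx trivial) (hy trivial)
  have : Module.Finite S (DirectSum ℕ H) := ⟨hGtop ▸ hGfg⟩
  have : IsNoetherian S (DirectSum ℕ H) := isNoetherian_of_isNoetherianRing_of_finite _ _
  have hstable : ∀ (s : S) (m : DirectSum ℕ H), (∀ i, m i ∈ P i) → ∀ i, (s • m) i ∈ P i := by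
    intro s
    induction s using MvPolynomial.induction_on with
    | C a =>
      intro m hm i
      rw [hC, DirectSum.smul_apply]
      exact (P i).smul_mem _ (hm i)
    | add p q hp hq =>
      intro m hm i
      rw [add_smul, DirectSum.add_apply]
      exact add_mem (hp m hm i) (hq m hm i)
    | mul_X p k hp =>
      intro m hm i
      rw [mul_smul]
      refine hp _ (fun i => ?_) i
      rw [hX]
      by_cases hi : i < 2
      · rw [total_apply_zero _ _ _ _ hi]; exact zero_mem _
      · obtain ⟨j, rfl⟩ : ∃ j, i = j + 2 := ⟨i - 2, by omega⟩
        rw [total_apply]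
        exact hP _ _ _ (hm j)
  let PP : Submodule S (DirectSum ℕ H) :=
    { carrier := {m | ∀ i, m i ∈ P i}
      add_mem' := fun {a b} ha hb i => by
        rw [DirectSum.add_apply]; exact add_mem (ha i) (hb i)
      zero_mem' := fun i => by rw [DirectSum.zero_apply]; exact zero_mem _
      smul_mem' := fun s m hm => hstable s m hm }
  obtain ⟨T, hT⟩ := IsNoetherian.noetherian PP
  -- Beyond the largest degree occurring in the finitely many generators of `PP`, the components of
  -- these generators vanish and are trivially decomposable.
  obtain ⟨b, hb⟩ : ∃ b, ∀ m ∈ T, ∀ i, b ≤ i → m i = 0 := by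
    refine ⟨(T.sup fun m => m.support.sup id) + 1, fun m hm i hi => ?_⟩
    by_contra hne
    have h1 : i ≤ m.support.sup id := Finset.le_sup (f := id) (DFinsupp.mem_support_iff.2 hne)
    have h2 := Finset.le_sup (f := fun m : DirectSum ℕ H => m.support.sup id) hm
    have h3 := h1.trans h2
    omega
  -- Decomposability with coefficients in `P` passes from generators to all of `PP`. Scalars
  -- preserve it, and any `X_k • x` with `x` in `PP` has it outright, the components of `x` being
  -- the coefficients.
  let Dec : DirectSum ℕ H → Prop := fun m => ∀ i, b ≤ i → ∃ y : Fin c → H i,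
      (∀ k, y k ∈ P i) ∧ m (i + 2) = ∑ k, χ k i (y k)
  have hadd : ∀ x y, Dec x → Dec y → Dec (x + y) := by
    intro x y hx hy i hi
    obtain ⟨v, hv, hv'⟩ := hx i hi
    obtain ⟨w, hw, hw'⟩ := hy i hi
    refine ⟨v + w, fun k => add_mem (hv k) (hw k), ?_⟩
    rw [DirectSum.add_apply, hv', hw', ← Finset.sum_add_distrib]
    simp
  have hsmul : ∀ (s : S) (x : DirectSum ℕ H), (∀ i, x i ∈ P i) → Dec x → Dec (s • x) := by
    intro s
    induction s using MvPolynomial.induction_on with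
    | C a =>
      intro x _ hx i hi
      obtain ⟨v, hv, hv'⟩ := hx i hi
      refine ⟨a • v, fun k => (P i).smul_mem _ (hv k), ?_⟩
      rw [hC, DirectSum.smul_apply, hv', Finset.smul_sum]
      simp
    | add p q hp hq =>
      intro x hxP hx
      rw [add_smul]
      exact hadd _ _ (hp x hxP hx) (hq x hxP hx)
    | mul_X p k hp =>
      intro x hxP hx
      rw [mul_smul]
      refine hp _ (hstable _ _ hxP) fun i _ => ⟨Pi.single k (x i), fun l => ?_, ?_⟩
      · by_cases hl : l = k
        · subst hl; simpa using hxP i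
        · simp [hl]
      · rw [hX, total_apply, Finset.sum_eq_single k]
        · simp
        · intro l _ hl; simp [hl]
        · simp
  refine ⟨b, fun i hi x hx => ?_⟩
  have hxP : DirectSum.lof A ℕ H (i + 2) x ∈ PP := by
    intro j
    by_cases h : i + 2 = j
    · subst h; rw [DirectSum.lof_apply]; exact hx
    · rw [DirectSum.lof_eq_of, DirectSum.of_eq_of_ne _ _ _ (by omega)]; exact zero_mem _
  have hDec : ∀ m ∈ PP, Dec m := by
    intro m hm
    rw [← hT] at hm
    have : (∀ i, m i ∈ P i) ∧ Dec m := by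
      induction hm using Submodule.span_induction with
      | mem m hm =>
        exact ⟨(hT ▸ Submodule.subset_span hm : m ∈ PP), fun i hi =>
          ⟨0, fun k => zero_mem _, by rw [hb m hm _ (by omega)]; simp⟩⟩
      | zero => exact ⟨fun i => by rw [DirectSum.zero_apply]; exact zero_mem _,
          fun i hi => ⟨0, fun k => zero_mem _, by simp⟩⟩
      | add x y _ _ hx hy => exact ⟨PP.add_mem hx.1 hy.1, hadd _ _ hx.2 hy.2⟩
      | smul s x _ hx => exact ⟨hstable _ _ hx.1, hsmul _ _ hx.1 hx.2⟩
    exact this.2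
  obtain ⟨y, hy, hy'⟩ := hDec _ hxP i hi
  refine ⟨y, hy, ?_⟩
  rw [← hy', DirectSum.lof_apply]

end EventuallyGenerated

/-- If the kernel of a morphism to an eventually generated family is, in degrees at least two, the
image of one further operator, then the source is eventually generated. -/
theorem EventuallyGenerated.of_ker_le_range {A : Type u} [CommRing A] [IsNoetherianRing A] {c : ℕ}
    {H H' : ℕ → Type u} [∀ i, AddCommGroup (H i)] [∀ i, Module A (H i)]
    [∀ i, AddCommGroup (H' i)] [∀ i, Module A (H' i)] [∀ i, Module.Finite A (H' i)]
    (χ : Fin (c + 1) → ∀ i, H i →ₗ[A] H (i + 2)) (χ' : Fin c → ∀ i, H' i →ₗ[A] H' (i + 2))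
    (comm : ∀ j k i x, χ' j (i + 2) (χ' k i x) = χ' k (i + 2) (χ' j i x))
    (gen : EventuallyGenerated χ') (π : ∀ i, H i →ₗ[A] H' i)
    (hπ : ∀ k i x, π (i + 2) (χ (Fin.castSucc k) i x) = χ' k i (π i x))
    (hker : ∀ i x, π (i + 2) x = 0 → ∃ y, χ (Fin.last c) i y = x) : EventuallyGenerated χ := by
  -- The decomposition must take place inside the image of `π`, so that its coefficients lift to
  -- `H`; this is why generation of `H'` alone is not enough. The error after lifting lies in `ker
  -- π` and is absorbed by the last operator.
  obtain ⟨n, hn⟩ := gen.submodule χ' comm (fun i => LinearMap.range (π i)) (by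
    rintro k i _ ⟨x, rfl⟩
    exact ⟨_, hπ k i x⟩)
  refine ⟨n, fun i hi x => ?_⟩
  obtain ⟨y, hy, hxy⟩ := hn i hi (π (i + 2) x) ⟨x, rfl⟩
  choose z hz using hy
  obtain ⟨w, hw⟩ := hker i (x - ∑ k : Fin c, χ k.castSucc i (z k)) (by
    rw [map_sub, map_sum, hxy, sub_eq_zero]
    exact Finset.sum_congr rfl fun k _ => by rw [hπ, hz])
  refine ⟨Fin.lastCases w z, ?_⟩
  rw [Fin.sum_univ_castSucc]
  simp only [Fin.lastCases_last, Fin.lastCases_castSucc]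
  rw [hw]
  abel

/-! ### Free modules modulo an ideal. -/

section SmulTop

variable {Q : Type*} [CommRing Q] {M N : Type*} [AddCommGroup M] [Module Q M] [AddCommGroup N]
  [Module Q N]

theorem Ideal.map_mem_smul_top {J : Ideal Q} (f : M →ₗ[Q] N) {x : M}
    (hx : x ∈ J • (⊤ : Submodule Q M)) : f x ∈ J • (⊤ : Submodule Q N) := by
  have h := Submodule.mem_map_of_mem (f := f) hx
  rw [Submodule.map_smul''] at h
  exact Submodule.smul_mono le_rfl le_top h

theorem Ideal.mem_smul_top_iff_repr {ι : Type*} {J : Ideal Q} (b : Module.Basis ι Q M) {x : M} :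
    x ∈ J • (⊤ : Submodule Q M) ↔ ∀ i, b.repr x i ∈ J := by
  constructor
  · intro hx i
    simpa using Ideal.map_mem_smul_top (b.coord i) hx
  · intro h
    rw [← b.linearCombination_repr x, Finsupp.linearCombination_apply]
    exact Submodule.sum_mem _ fun i _ => Submodule.smul_mem_smul (h i) trivial

theorem Ideal.mem_span_range_smul_top_iff {ι : Type*} [Fintype ι] {f : ι → Q} {x : M} :
    x ∈ Ideal.span (Set.range f) • (⊤ : Submodule Q M) ↔ ∃ y : ι → M, x = ∑ k, f k • y k := by
  classical
  constructor
  · intro hx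
    refine Submodule.smul_induction_on hx ?_ ?_
    · intro r hr n _
      obtain ⟨c, rfl⟩ := (Ideal.mem_span_range_iff_exists_fun).1 hr
      exact ⟨fun k => c k • n, by simp only [Finset.sum_smul, smul_smul, mul_comm]⟩
    · rintro _ _ ⟨a, rfl⟩ ⟨b, rfl⟩
      exact ⟨a + b, by simp [Finset.sum_add_distrib]⟩
  · rintro ⟨y, rfl⟩
    exact Submodule.sum_mem _ fun k _ => Submodule.smul_mem_smul (Ideal.subset_span ⟨k, rfl⟩) trivial

/-- A linear map on a free module with values in `(f₁, …, f_c) N` is a combination of the `f_k`. -/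
theorem LinearMap.exists_eq_sum_smul [Module.Free Q M] {ι : Type*} [Fintype ι] {f : ι → Q}
    (a : M →ₗ[Q] N) (ha : ∀ x, a x ∈ Ideal.span (Set.range f) • (⊤ : Submodule Q N)) :
    ∃ g : ι → M →ₗ[Q] N, ∀ x, a x = ∑ k, f k • g k x := by
  let b := Module.Free.chooseBasis Q M
  choose y hy using fun i => Ideal.mem_span_range_smul_top_iff.1 (ha (b i))
  refine ⟨fun k => b.constr Q fun i => y i k, fun x => ?_⟩
  have : a = ∑ k, f k • b.constr Q fun i => y i k := by
    apply b.ext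
    intro i
    simp [hy]
  conv_lhs => rw [this]
  simp

theorem mem_smul_top_of_sum_smul_eq_zero [Module.Free Q M] {c : ℕ} {f : Fin c → Q}
    (hf : RingTheory.Sequence.IsWeaklyRegular Q (List.ofFn f)) {x : Fin c → M}
    (hx : ∑ k, f k • x k = 0) (k : Fin c) :
    x k ∈ Ideal.span (Set.range f) • (⊤ : Submodule Q M) := by
  let b := Module.Free.chooseBasis Q M
  rw [Ideal.mem_smul_top_iff_repr b]
  intro i
  refine TotallyAcyclic.mem_span_of_sum_eq_zero f hf (fun k => b.repr (x k) i) ?_ k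
  have := congrArg (fun z => b.repr z i) hx
  simpa [Finsupp.finsetSum_apply] using this

theorem mem_smul_top_of_smul_mem [Module.Free Q M] {J : Ideal Q} {a : Q}
    (ha : ∀ y, a * y ∈ J → y ∈ J) {x : M} (hx : a • x ∈ J • (⊤ : Submodule Q M)) :
    x ∈ J • (⊤ : Submodule Q M) := by
  let b := Module.Free.chooseBasis Q M
  rw [Ideal.mem_smul_top_iff_repr b] at hx ⊢
  intro i
  exact ha _ (by simpa using hx i)

theorem mem_sup_span_singleton_smul_top {J : Ideal Q} {a : Q} {x : M}
    (hx : x ∈ (J ⊔ Ideal.span {a}) • (⊤ : Submodule Q M)) :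
    ∃ y, x - a • y ∈ J • (⊤ : Submodule Q M) := by
  rw [Submodule.sup_smul, Submodule.mem_sup] at hx
  obtain ⟨u, hu, v, hv, rfl⟩ := hx
  rw [Submodule.ideal_span_singleton_smul, Submodule.mem_smul_pointwise_iff_exists] at hv
  obtain ⟨y, -, rfl⟩ := hv
  exact ⟨y, by simpa using hu⟩

theorem sub_mem_sup_span_singleton_smul_top {J : Ideal Q} {a : Q} {x y : M}
    (hx : x - a • y ∈ J • (⊤ : Submodule Q M)) :
    x ∈ (J ⊔ Ideal.span {a}) • (⊤ : Submodule Q M) := by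
  have h : x = (x - a • y) + a • y := by abel
  rw [h]
  exact add_mem (Submodule.smul_mono_left le_sup_left hx)
    (Submodule.smul_mem_smul (Ideal.mem_sup_right (Ideal.mem_span_singleton_self a)) trivial)

/-- Modulo a maximal ideal every linear map of free modules has a generalised inverse. -/
theorem LinearMap.exists_generalizedInverse_mod [Module.Free Q M] [Module.Free Q N] (I : Ideal Q)
    [I.IsMaximal] (d : M →ₗ[Q] N) :
    ∃ g : N →ₗ[Q] M, ∀ x, d (g (d x)) - d x ∈ I • (⊤ : Submodule Q N) := by
  let _ : Field (Q ⧸ I) := Ideal.Quotient.field I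
  let V := M ⧸ (I • ⊤ : Submodule Q M)
  let W := N ⧸ (I • ⊤ : Submodule Q N)
  let d₀ : V →ₗ[Q] W := Submodule.mapQ _ _ d fun x hx => Ideal.map_mem_smul_top d hx
  let d₁ : V →ₗ[Q ⧸ I] W := d₀.extendScalarsOfSurjective Ideal.Quotient.mk_surjective
  obtain ⟨r, hr⟩ := d₁.rangeRestrict.exists_rightInverse_of_surjective
    (LinearMap.range_rangeRestrict d₁)
  obtain ⟨e, he⟩ := (LinearMap.range d₁).subtype.exists_leftInverse_of_injective
    (Submodule.ker_subtype _)
  -- Over the field `Q/I`, project onto the image of `d` by `e` and return by a section `r`. Since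
  -- `N` is free, the composite lifts to `Q`.
  obtain ⟨g, hg⟩ := Module.projective_lifting_property (Submodule.mkQ (I • ⊤ : Submodule Q M))
    (((r ∘ₗ e).restrictScalars Q) ∘ₗ (Submodule.mkQ (I • ⊤ : Submodule Q N)))
    (Submodule.mkQ_surjective _)
  refine ⟨g, fun x => ?_⟩
  rw [← Submodule.Quotient.mk_eq_zero, Submodule.Quotient.mk_sub, sub_eq_zero]
  have h1 : Submodule.Quotient.mk (d (g (d x))) = d₁ (Submodule.Quotient.mk (g (d x))) := rfl
  have h2 : (Submodule.Quotient.mk (g (d x)) : V) = r (e (Submodule.Quotient.mk (d x))) :=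
    LinearMap.congr_fun hg (d x)
  have h3 : (Submodule.Quotient.mk (d x) : W) = d₁ (Submodule.Quotient.mk x) := rfl
  have h4 : e (d₁ (Submodule.Quotient.mk x)) = d₁.rangeRestrict (Submodule.Quotient.mk x) :=
    LinearMap.congr_fun he (d₁.rangeRestrict (Submodule.Quotient.mk x))
  have h5 : ∀ y, d₁ (r y) = y := fun y => congrArg Subtype.val (LinearMap.congr_fun hr y)
  rw [h1, h2, h3, h4, h5]
  rfl

end SmulTop

/-! ### Exactness modulo ideals and contractibility over a regular local ring. -/

section Contractible

variable {Q : Type*} [CommRing Q] {M : ℤ → Type*} [∀ p, AddCommGroup (M p)]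
  [∀ p, Module Q (M p)]

/-- A sequence of maps that is exact modulo an ideal. -/
def ExactModulo (J : Ideal Q) (d : ∀ p, M p →ₗ[Q] M (p + 1)) : Prop :=
  ∀ p (x : M (p + 1)), d (p + 1) x ∈ J • (⊤ : Submodule Q (M (p + 1 + 1))) →
    ∃ w, x - d p w ∈ J • (⊤ : Submodule Q (M (p + 1)))

variable {d : ∀ p, M p →ₗ[Q] M (p + 1)}

/-- This is the long exact sequence of multiplication by `a` on the complex modulo `J`. If `dx ≡
ay`, then `y` is a cycle since `a` is regular, so `y ≡ dz`. Now `x - az` is a cycle modulo `J`,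
hence a boundary. Exactness is used in two consecutive degrees. -/
theorem ExactModulo.sup_span_singleton [∀ p, Module.Free Q (M p)] (hd : ∀ p x, d (p + 1) (d p x) = 0)
    {J : Ideal Q} (h : ExactModulo J d) {a : Q} (ha : ∀ y, a * y ∈ J → y ∈ J) :
    ExactModulo (J ⊔ Ideal.span {a}) d := by
  intro p x hx
  obtain ⟨y, hy⟩ := mem_sup_span_singleton_smul_top hx
  have h1 : a • d (p + 1 + 1) y ∈ J • (⊤ : Submodule Q (M (p + 1 + 1 + 1))) := by
    have := Ideal.map_mem_smul_top (d (p + 1 + 1)) hy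
    rwa [map_sub, hd, zero_sub, neg_mem_iff, map_smul] at this
  obtain ⟨z, hz⟩ := h _ _ (mem_smul_top_of_smul_mem ha h1)
  have h2 : d (p + 1) (x - a • z) ∈ J • (⊤ : Submodule Q (M (p + 1 + 1))) := by
    have : d (p + 1) (x - a • z) = (d (p + 1) x - a • y) + a • (y - d (p + 1) z) := by
      rw [map_sub, map_smul, smul_sub]; abel
    rw [this]
    exact add_mem hy (Submodule.smul_mem _ _ hz)
  obtain ⟨w, hw⟩ := h _ _ h2
  refine ⟨w, sub_mem_sup_span_singleton_smul_top (y := z) ?_⟩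
  rwa [sub_right_comm]

theorem ExactModulo.of_generatedByRegularSequence [∀ p, Module.Free Q (M p)]
    (hd : ∀ p x, d (p + 1) (d p x) = 0) (h : ExactModulo ⊥ d) {J : Ideal Q}
    (hJ : J.GeneratedByRegularSequence) : ExactModulo J d := by
  induction hJ with
  | bot => exact h
  | sup _ ha ih => exact ih.sup_span_singleton hd ha

/-- An exact sequence of finitely generated free modules over a regular local ring, unbounded
in both directions, is contractible. -/
theorem ExactModulo.exists_contraction [IsRegularLocalRing Q] [∀ p, Module.Free Q (M p)]
    [∀ p, Module.Finite Q (M p)] (hd : ∀ p x, d (p + 1) (d p x) = 0) (h : ExactModulo ⊥ d) :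
    ∃ s : ∀ p, M (p + 1) →ₗ[Q] M p, ∀ p x, d p (s p x) + s (p + 1) (d (p + 1) x) = x := by
  have hm := h.of_generatedByRegularSequence hd
    (IsRegularLocalRing.generatedByRegularSequence_maximalIdeal Q)
  set I := IsLocalRing.maximalIdeal Q with hI
  choose g hg using fun p => LinearMap.exists_generalizedInverse_mod I (d p)
  -- Modulo `I`, the element `x - g d x` is a cycle, hence a boundary, and `d g` is the identity on
  -- boundaries. So `d s x ≡ x - g d x`, while `s d x = g d x`; therefore `ds + sd ≡ 1`.
  let s : ∀ p, M (p + 1) →ₗ[Q] M p := fun p => g p ∘ₗ (LinearMap.id - g (p + 1) ∘ₗ d (p + 1))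
  have hs : ∀ p x, s p x = g p (x - g (p + 1) (d (p + 1) x)) := fun p x => rfl
  let u : ∀ p, M (p + 1) →ₗ[Q] M (p + 1) := fun p => d p ∘ₗ s p + s (p + 1) ∘ₗ d (p + 1)
  have hu : ∀ p x, u p x = d p (s p x) + s (p + 1) (d (p + 1) x) := fun p x => rfl
  have hu1 : ∀ p x, u p x - x ∈ I • (⊤ : Submodule Q (M (p + 1))) := by
    intro p x
    set y := x - g (p + 1) (d (p + 1) x) with hy
    have h1 : d (p + 1) y ∈ I • (⊤ : Submodule Q (M (p + 1 + 1))) := by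
      rw [hy, map_sub, ← neg_mem_iff, neg_sub]
      exact hg _ _
    obtain ⟨w, hw⟩ := hm _ _ h1
    have h2 : u p x - x = d p (g p (y - d p w)) + (d p (g p (d p w)) - d p w) - (y - d p w) := by
      have h3 : g (p + 1) (d (p + 1) x) - x = -y := by rw [hy]; abel
      rw [hu, hs, hs, hd, map_zero, sub_zero, ← hy, add_sub_assoc, h3, map_sub (g p) y, map_sub (d p)]
      abel
    rw [h2]
    exact sub_mem (add_mem (Ideal.map_mem_smul_top (d p ∘ₗ g p) hw) (hg _ _)) hw
  -- An endomorphism of a finitely generated module that is the identity modulo `m` is surjective by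
  -- Nakayama, hence bijective.
  have hbij : ∀ p, Function.Bijective (u p) := fun p => by
    apply OrzechProperty.bijective_of_surjective_endomorphism
    rw [← LinearMap.range_eq_top, eq_top_iff]
    apply Submodule.le_of_le_smul_of_le_jacobson_bot (I := I) Module.Finite.fg_top
    · rw [IsLocalRing.jacobson_eq_maximalIdeal _ bot_ne_top]
    · intro x _
      have : x = u p x - (u p x - x) := by abel
      rw [this]
      exact sub_mem (Submodule.mem_sup_left ⟨x, rfl⟩) (Submodule.mem_sup_right (hu1 p x))
  let e : ∀ p, M (p + 1) ≃ₗ[Q] M (p + 1) := fun p => LinearEquiv.ofBijective (u p) (hbij p)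
  have he : ∀ p x, e p x = u p x := fun p x => rfl
  -- The automorphism `u = ds + sd` commutes with `d`, so composing `s` with its inverse turns it
  -- into a contraction.
  refine ⟨fun p => s p ∘ₗ (e p).symm.toLinearMap, fun p x => ?_⟩
  obtain ⟨x, rfl⟩ := (e p).surjective x
  have h1 : d (p + 1) (e p x) = e (p + 1) (d (p + 1) x) := by
    rw [he, he, hu, hu, map_add, hd, hd, map_zero, zero_add, add_zero]
  simp only [LinearMap.comp_apply, LinearEquiv.coe_coe, h1, LinearEquiv.symm_apply_apply]
  rw [he, hu]

end Contractible

/-! ### Curved complexes and their cohomology operators. -/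

/-- A sequence of finitely generated free `Q`-modules with maps `d` whose square is
`∑ f_k t_k`. -/
structure CurvedComplex {Q : Type u} [CommRing Q] {c : ℕ} (f : Fin c → Q) where
  /-- the modules -/
  M : ℤ → Type u
  [addCommGroup : ∀ p, AddCommGroup (M p)]
  [module : ∀ p, Module Q (M p)]
  [free : ∀ p, Module.Free Q (M p)]
  [finite : ∀ p, Module.Finite Q (M p)]
  /-- the differentials -/
  d : ∀ p, M p →ₗ[Q] M (p + 1)
  /-- the components of the square of the differential -/
  t : Fin c → ∀ p, M p →ₗ[Q] M (p + 1 + 1)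
  d_d : ∀ p x, d (p + 1) (d p x) = ∑ k, f k • t k p x

namespace CurvedComplex

attribute [instance] addCommGroup module free finite

section Weakly

variable {Q : Type*} [CommRing Q] {c : ℕ} {f : Fin (c + 1) → Q}

theorem isWeaklyRegular_castSucc (hf : RingTheory.Sequence.IsWeaklyRegular Q (List.ofFn f)) :
    RingTheory.Sequence.IsWeaklyRegular Q (List.ofFn fun k : Fin c => f k.castSucc) := by
  rw [List.ofFn_succ', List.concat_eq_append,
    RingTheory.Sequence.isWeaklyRegular_append_iff] at hf
  exact hf.1

theorem mem_of_last_mul_mem (hf : RingTheory.Sequence.IsWeaklyRegular Q (List.ofFn f)) (y : Q)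
    (hy : f (Fin.last c) * y ∈ Ideal.span (Set.range fun k : Fin c => f k.castSucc)) :
    y ∈ Ideal.span (Set.range fun k : Fin c => f k.castSucc) := by
  rw [List.ofFn_succ', List.concat_eq_append,
    RingTheory.Sequence.isWeaklyRegular_append_iff] at hf
  have hf2 := hf.2
  rw [RingTheory.Sequence.isWeaklyRegular_singleton_iff] at hf2
  have h0 : (Submodule.Quotient.mk y : Q ⧸
      (Ideal.ofList (List.ofFn fun k : Fin c => f k.castSucc) • ⊤ : Submodule Q Q)) = 0 := by
    apply hf2.right_eq_zero_of_smul
    rw [← Submodule.Quotient.mk_smul, Submodule.Quotient.mk_eq_zero, TotallyAcyclic.ofList_ofFn]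
    simpa using hy
  rw [Submodule.Quotient.mk_eq_zero, TotallyAcyclic.ofList_ofFn] at h0
  simpa using h0

theorem span_range_eq_sup : Ideal.span (Set.range f) =
    Ideal.span (Set.range fun k : Fin c => f k.castSucc) ⊔ Ideal.span {f (Fin.last c)} := by
  rw [← Ideal.span_union]
  congr 1
  ext x
  simp [Fin.exists_fin_succ', eq_comm, or_comm]

end Weakly

variable {Q : Type u} [CommRing Q] {c : ℕ} {f : Fin c → Q}

/-- Both `d ∘ d²` and `d² ∘ d` compute `d³`. -/
theorem sum_commutator (X : CurvedComplex f) (p : ℤ) (x : X.M p) :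
    ∑ k, f k • (X.d (p + 1 + 1) (X.t k p x) - X.t k (p + 1) (X.d p x)) = 0 := by
  have h1 := congrArg (X.d (p + 1 + 1)) (X.d_d p x)
  rw [X.d_d (p + 1) (X.d p x), map_sum] at h1
  simp only [map_smul] at h1
  simp only [smul_sub, Finset.sum_sub_distrib, h1, sub_self]

theorem commutator_mem (X : CurvedComplex f)
    (hf : RingTheory.Sequence.IsWeaklyRegular Q (List.ofFn f)) (k : Fin c) (p : ℤ) (x : X.M p) :
    X.d (p + 1 + 1) (X.t k p x) - X.t k (p + 1) (X.d p x) ∈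
      Ideal.span (Set.range f) • (⊤ : Submodule Q (X.M (p + 1 + 1 + 1))) :=
  mem_smul_top_of_sum_smul_eq_zero hf (X.sum_commutator p x) k

/-! ### Cochains with values in a complex -/

variable (X : CurvedComplex f) (D : CochainComplex (ModuleCat.{u} Q) ℤ)

/-- Families of maps from `X` to `D`. A cochain of degree `i` is given by the components with
`p + i = q`; the other components are irrelevant. -/
abbrev Cochain : Type u := ∀ p q : ℤ, X.M p →ₗ[Q] D.X q

/-- The cochains that commute with the differentials in degree `i`. -/
def cocycles (i : ℤ) : Submodule Q (X.Cochain D) where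
  carrier := {φ | ∀ p q r, p + i = q → q + 1 = r → ∀ x,
    (D.d q r).hom (φ p q x) = φ (p + 1) r (X.d p x)}
  add_mem' ha hb p q r h1 h2 x := by
    simp only [Pi.add_apply, LinearMap.add_apply, map_add, ha p q r h1 h2, hb p q r h1 h2]
  zero_mem' p q r _ _ x := by simp
  smul_mem' a φ h p q r h1 h2 x := by
    simp only [Pi.smul_apply, LinearMap.smul_apply, map_smul, h p q r h1 h2]

/-- The cochains that are homotopic to zero in degree `i`. -/
def boundaries (i : ℤ) : Submodule Q (X.Cochain D) where
  carrier := {φ | ∃ h : X.Cochain D, ∀ p q r, p + i = r → q + 1 = r → ∀ x,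
    φ p r x = (D.d q r).hom (h p q x) + h (p + 1) r (X.d p x)}
  add_mem' := by
    rintro φ ψ ⟨h, hh⟩ ⟨g, hg⟩
    refine ⟨h + g, fun p q r h1 h2 x => ?_⟩
    simp only [Pi.add_apply, LinearMap.add_apply, map_add, hh p q r h1 h2, hg p q r h1 h2]
    abel
  zero_mem' := ⟨0, fun p q r _ _ x => by simp⟩
  smul_mem' := by
    rintro a φ ⟨h, hh⟩
    refine ⟨a • h, fun p q r h1 h2 x => ?_⟩
    simp only [Pi.smul_apply, LinearMap.smul_apply, map_smul, hh p q r h1 h2, smul_add]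

/-- Cocycles modulo boundaries. -/
abbrev Cohomology (i : ℤ) : Type u :=
  X.cocycles D i ⧸ (X.boundaries D i).submoduleOf (X.cocycles D i)

variable {D}

/-- The class of a cocycle. -/
abbrev classOf {i : ℤ} (φ : X.Cochain D) (h : φ ∈ X.cocycles D i) : X.Cohomology D i :=
  Submodule.Quotient.mk ⟨φ, h⟩

variable {X}

theorem classOf_eq_zero_iff {i : ℤ} {φ : X.Cochain D} (h : φ ∈ X.cocycles D i) :
    X.classOf φ h = 0 ↔ φ ∈ X.boundaries D i :=
  Submodule.Quotient.mk_eq_zero _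

theorem exists_classOf_eq {i : ℤ} (x : X.Cohomology D i) : ∃ φ h, X.classOf φ h = x := by
  obtain ⟨⟨φ, h⟩, rfl⟩ := Submodule.Quotient.mk_surjective _ x
  exact ⟨φ, h, rfl⟩

/-- The map on cohomology induced by a map of cochains. -/
def cohomologyMap {c' : ℕ} {f' : Fin c' → Q} {X' : CurvedComplex f'} {i j : ℤ}
    (T : X.Cochain D →ₗ[Q] X'.Cochain D) (hZ : ∀ φ ∈ X.cocycles D i, T φ ∈ X'.cocycles D j)
    (hB : ∀ φ ∈ X.boundaries D i, T φ ∈ X'.boundaries D j) :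
    X.Cohomology D i →ₗ[Q] X'.Cohomology D j :=
  Submodule.mapQ _ _ (T.restrict hZ) fun φ hφ => hB φ.1 hφ

theorem apply_eq_zero (hD : ∀ k q (x : D.X q), f k • x = 0) {M : Type*} [AddCommGroup M]
    [Module Q M] {q : ℤ} (φ : M →ₗ[Q] D.X q) {x : M}
    (hx : x ∈ Ideal.span (Set.range f) • (⊤ : Submodule Q M)) : φ x = 0 := by
  obtain ⟨y, rfl⟩ := Ideal.mem_span_range_smul_top_iff.1 hx
  simp [hD]

theorem apply_d_d (hD : ∀ k q (x : D.X q), f k • x = 0) {p q : ℤ}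
    (φ : X.M (p + 1 + 1) →ₗ[Q] D.X q) (x : X.M p) : φ (X.d (p + 1) (X.d p x)) = 0 := by
  rw [X.d_d, map_sum]
  simp [hD]

/-- The square of `d` on `X` is not zero, but it has values in `(f) M`, which every map to `D`
kills. -/
theorem boundaries_le_cocycles (hD : ∀ k q (x : D.X q), f k • x = 0) (i : ℤ) :
    X.boundaries D i ≤ X.cocycles D i := by
  rintro φ ⟨h, hh⟩ p q r h1 h2 x
  rw [hh p (q - 1) q h1 (by ring), hh (p + 1) q r (by omega) h2, map_add, apply_d_d hD, add_zero]
  have := LinearMap.congr_fun (congrArg ModuleCat.Hom.hom (D.d_comp_d (q - 1) q r)) (h p (q - 1) x)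
  simp only [ModuleCat.hom_comp, LinearMap.comp_apply] at this
  rw [this]
  simp

variable (X) in
/-- Composition of cochains with `t_k`. -/
def compT (k : Fin c) : X.Cochain D →ₗ[Q] X.Cochain D where
  toFun φ p q := φ (p + 1 + 1) q ∘ₗ X.t k p
  map_add' _ _ := rfl
  map_smul' _ _ := rfl

theorem compT_apply (k : Fin c) (φ : X.Cochain D) (p q : ℤ) (x : X.M p) :
    X.compT k φ p q x = φ (p + 1 + 1) q (X.t k p x) :=
  rfl

theorem apply_commutator (hf : RingTheory.Sequence.IsWeaklyRegular Q (List.ofFn f))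
    (hD : ∀ k q (x : D.X q), f k • x = 0) (k : Fin c) {p q : ℤ}
    (φ : X.M (p + 1 + 1 + 1) →ₗ[Q] D.X q) (x : X.M p) :
    φ (X.d (p + 1 + 1) (X.t k p x)) = φ (X.t k (p + 1) (X.d p x)) := by
  rw [← sub_eq_zero, ← map_sub]
  exact apply_eq_zero hD φ (X.commutator_mem hf k p x)

theorem compT_mem_cocycles (hf : RingTheory.Sequence.IsWeaklyRegular Q (List.ofFn f))
    (hD : ∀ k q (x : D.X q), f k • x = 0) (k : Fin c) {i j : ℤ} (hij : i + 2 = j)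
    (φ : X.Cochain D) (hφ : φ ∈ X.cocycles D i) : X.compT k φ ∈ X.cocycles D j := by
  intro p q r h1 h2 x
  rw [compT_apply, compT_apply, hφ (p + 1 + 1) q r (by omega) h2, apply_commutator hf hD]

theorem compT_mem_boundaries (hf : RingTheory.Sequence.IsWeaklyRegular Q (List.ofFn f))
    (hD : ∀ k q (x : D.X q), f k • x = 0) (k : Fin c) {i j : ℤ} (hij : i + 2 = j)
    (φ : X.Cochain D) (hφ : φ ∈ X.boundaries D i) : X.compT k φ ∈ X.boundaries D j := by
  obtain ⟨h, hh⟩ := hφ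
  refine ⟨X.compT k h, fun p q r h1 h2 x => ?_⟩
  rw [compT_apply, compT_apply, compT_apply, hh (p + 1 + 1) q r (by omega) h2,
    apply_commutator hf hD]

variable (X) in
/-- The operator `χ_k` on cohomology. -/
def chi (hf : RingTheory.Sequence.IsWeaklyRegular Q (List.ofFn f))
    (hD : ∀ k q (x : D.X q), f k • x = 0) (k : Fin c) {i j : ℤ} (hij : i + 2 = j) :
    X.Cohomology D i →ₗ[Q] X.Cohomology D j :=
  cohomologyMap (X.compT k) (compT_mem_cocycles hf hD k hij) (compT_mem_boundaries hf hD k hij)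

theorem chi_classOf (hf : RingTheory.Sequence.IsWeaklyRegular Q (List.ofFn f))
    (hD : ∀ k q (x : D.X q), f k • x = 0) (k : Fin c) {i j : ℤ} (hij : i + 2 = j)
    (φ : X.Cochain D) (hφ : φ ∈ X.cocycles D i) :
    X.chi hf hD k hij (X.classOf φ hφ) =
      X.classOf (X.compT k φ) (compT_mem_cocycles hf hD k hij φ hφ) :=
  rfl

/-- Write `[d, t_k] = ∑ f_l v_l` and expand `d² t_k` in two ways. This gives `∑ f_l (t_l t_k - t_k
t_l - d v_l - v_l d) = 0`. By regularity each bracket vanishes modulo `(f)`, so composing a cocycle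
with `v_l` gives the homotopy. -/
theorem chi_comm (hf : RingTheory.Sequence.IsWeaklyRegular Q (List.ofFn f))
    (hD : ∀ k q (x : D.X q), f k • x = 0) (k l : Fin c) {i j m : ℤ} (hij : i + 2 = j)
    (hjm : j + 2 = m) (x : X.Cohomology D i) :
    X.chi hf hD k hjm (X.chi hf hD l hij x) = X.chi hf hD l hjm (X.chi hf hD k hij x) := by
  obtain ⟨φ, hφ, rfl⟩ := exists_classOf_eq x
  rw [chi_classOf, chi_classOf, chi_classOf, chi_classOf, ← sub_eq_zero]
  change X.classOf (X.compT k (X.compT l φ) - X.compT l (X.compT k φ)) _ = 0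
  rw [classOf_eq_zero_iff]
  choose v hv using fun p => LinearMap.exists_eq_sum_smul
    (X.d (p + 1 + 1) ∘ₗ X.t k p - X.t k (p + 1) ∘ₗ X.d p) (X.commutator_mem hf k p)
  have hv' : ∀ p x, X.d (p + 1 + 1) (X.t k p x) = X.t k (p + 1) (X.d p x) +
      ∑ l, f l • v p l x := fun p x => by
    rw [← hv p x]; simp
  have key : ∀ p x, X.t l (p + 1 + 1) (X.t k p x) - X.t k (p + 1 + 1) (X.t l p x) -
      (X.d (p + 1 + 1 + 1) (v p l x) + v (p + 1) l (X.d p x)) ∈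
        Ideal.span (Set.range f) • (⊤ : Submodule Q (X.M (p + 1 + 1 + 1 + 1))) := by
    intro p x
    refine mem_smul_top_of_sum_smul_eq_zero hf (x := fun l =>
      X.t l (p + 1 + 1) (X.t k p x) - X.t k (p + 1 + 1) (X.t l p x) -
      (X.d (p + 1 + 1 + 1) (v p l x) + v (p + 1) l (X.d p x))) ?_ l
    have h1 := X.d_d (p + 1 + 1) (X.t k p x)
    have h2 := congrArg (X.t k (p + 1 + 1)) (X.d_d p x)
    rw [hv', map_add, hv', map_sum, h2, map_sum] at h1
    simp only [map_smul] at h1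
    simp only [smul_sub, smul_add, Finset.sum_sub_distrib, Finset.sum_add_distrib, ← h1]
    abel
  refine ⟨fun p q => φ (p + 1 + 1 + 1) q ∘ₗ v p l, fun p q r h1 h2 x => ?_⟩
  have h3 := apply_eq_zero hD (φ (p + 1 + 1 + 1 + 1) r) (key p x)
  simp only [map_sub, map_add] at h3
  have h4 := hφ (p + 1 + 1 + 1) q r (by omega) h2 (v p l x)
  simp only [Pi.sub_apply, LinearMap.sub_apply, compT_apply,
    LinearMap.comp_apply, h4]
  exact sub_eq_zero.1 h3

end CurvedComplex

namespace CurvedComplex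

variable {Q : Type u} [CommRing Q] {c : ℕ}

section ShiftIndex

variable {f : Fin c → Q} (X : CurvedComplex f) (D : CochainComplex (ModuleCat.{u} Q) ℤ)

/-- Families of maps on `X` are determined by their components with shifted index. -/
def shiftIndex : X.Cochain D ≃ₗ[Q] ∀ p q : ℤ, X.M (p + 1) →ₗ[Q] D.X q :=
  LinearEquiv.piCongrLeft' Q (fun p => ∀ q, X.M p →ₗ[Q] D.X q) (Equiv.addRight (1 : ℤ)).symm

variable {X D} in
theorem shiftIndex_symm_apply (φ : ∀ p q : ℤ, X.M (p + 1) →ₗ[Q] D.X q) (p q : ℤ) :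
    (X.shiftIndex D).symm φ (p + 1) q = φ p q :=
  congrFun (congrFun ((X.shiftIndex D).apply_symm_apply φ) p) q

end ShiftIndex

/-! ### The cone of the last operator. -/

section Cone

variable {f : Fin (c + 1) → Q} (X : CurvedComplex f)

/-- A choice of maps witnessing that the last operator commutes with the differentials modulo
the first `c` elements. -/
def CommutatorLift : Type u :=
  { u : Fin c → ∀ p, X.M p →ₗ[Q] X.M (p + 1 + 1 + 1) //
    ∀ p x, X.d (p + 1 + 1) (X.t (Fin.last c) p x) - X.t (Fin.last c) (p + 1) (X.d p x) =
      ∑ k : Fin c, f k.castSucc • u k p x }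

/-- The relation `∑ f_k [d, t_k] = 0` puts the last term into the ideal of the first `c` elements,
and regularity cancels the factor `f (Fin.last c)`. -/
theorem nonempty_commutatorLift (hf : RingTheory.Sequence.IsWeaklyRegular Q (List.ofFn f)) :
    Nonempty X.CommutatorLift := by
  have h : ∀ p x, (X.d (p + 1 + 1) ∘ₗ X.t (Fin.last c) p - X.t (Fin.last c) (p + 1) ∘ₗ X.d p) x ∈
      Ideal.span (Set.range fun k : Fin c => f k.castSucc) •
        (⊤ : Submodule Q (X.M (p + 1 + 1 + 1))) := by
    intro p x
    refine mem_smul_top_of_smul_mem (mem_of_last_mul_mem hf) ?_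
    have h1 := X.sum_commutator p x
    rw [Fin.sum_univ_castSucc] at h1
    rw [LinearMap.sub_apply, LinearMap.comp_apply, LinearMap.comp_apply,
      eq_neg_of_add_eq_zero_right h1]
    exact neg_mem (Ideal.mem_span_range_smul_top_iff.2 ⟨_, rfl⟩)
  choose v hv using fun p => LinearMap.exists_eq_sum_smul _ (h p)
  exact ⟨⟨fun k p => v p k, fun p x => (hv p x)⟩⟩

variable {X}

/-- The cone of the last operator, lifted to a curved complex over one element less. -/
def cone (v : X.CommutatorLift) : CurvedComplex fun k : Fin c => f k.castSucc where
  M p := X.M p × X.M (p + 1)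
  -- The map is `d(a, b) = (da + f_c b, -(t_c a + db))`, with `c` here standing for the last index.
  -- In its square the curvature term `f_c t_c` cancels on both summands; what is left off the
  -- diagonal is `[d, t_c]`, which `v` rewrites in terms of the other `f_k`.
  d p := LinearMap.prod
    (LinearMap.coprod (X.d p) (f (Fin.last c) • LinearMap.id))
    (-LinearMap.coprod (X.t (Fin.last c) p) (X.d (p + 1)))
  t k p := LinearMap.prod (X.t k.castSucc p ∘ₗ LinearMap.fst Q _ _)
    (LinearMap.coprod (v.1 k p) (X.t k.castSucc (p + 1)))
  d_d p x := by
    obtain ⟨a, b⟩ := x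
    have h1 := X.d_d p a
    have h2 := X.d_d (p + 1) b
    have h3 := v.2 p a
    rw [Fin.sum_univ_castSucc] at h1 h2
    ext
    · simp [Prod.fst_sum, h1]
    · simp only [LinearMap.prod_apply, Function.prod_apply, LinearMap.coprod_apply, LinearMap.neg_apply,
        LinearMap.smul_apply, LinearMap.id_apply, map_add, map_neg, map_smul, h2, Prod.snd_sum,
        Prod.smul_snd, smul_add, Finset.sum_add_distrib, ← h3]
      abel

/-- The inclusion of the first summand of the cone. -/
def coneInl (v : X.CommutatorLift) (p : ℤ) : X.M p →ₗ[Q] (cone v).M p :=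
  LinearMap.inl Q (X.M p) (X.M (p + 1))

/-- The inclusion of the second summand of the cone. -/
def coneInr (v : X.CommutatorLift) (p : ℤ) : X.M (p + 1) →ₗ[Q] (cone v).M p :=
  LinearMap.inr Q (X.M p) (X.M (p + 1))

/-- The projection to the first summand of the cone. -/
def coneFst (v : X.CommutatorLift) (p : ℤ) : (cone v).M p →ₗ[Q] X.M p :=
  LinearMap.fst Q (X.M p) (X.M (p + 1))

/-- The projection to the second summand of the cone. -/
def coneSnd (v : X.CommutatorLift) (p : ℤ) : (cone v).M p →ₗ[Q] X.M (p + 1) :=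
  LinearMap.snd Q (X.M p) (X.M (p + 1))

variable (v : X.CommutatorLift)

@[simp] theorem coneFst_inl (p : ℤ) (a : X.M p) : coneFst v p (coneInl v p a) = a := rfl

@[simp] theorem coneSnd_inl (p : ℤ) (a : X.M p) : coneSnd v p (coneInl v p a) = 0 := rfl

@[simp] theorem coneFst_inr (p : ℤ) (b : X.M (p + 1)) : coneFst v p (coneInr v p b) = 0 := rfl

@[simp] theorem coneSnd_inr (p : ℤ) (b : X.M (p + 1)) : coneSnd v p (coneInr v p b) = b := rfl

theorem cone_eq (p : ℤ) (y : (cone v).M p) :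
    y = coneInl v p (coneFst v p y) + coneInr v p (coneSnd v p y) := by
  obtain ⟨a, b⟩ : X.M p × X.M (p + 1) := y
  exact Prod.ext (add_zero a).symm (zero_add b).symm

theorem coneFst_d (p : ℤ) (y : (cone v).M p) : coneFst v (p + 1) ((cone v).d p y) =
    X.d p (coneFst v p y) + f (Fin.last c) • coneSnd v p y :=
  rfl

theorem coneSnd_d (p : ℤ) (y : (cone v).M p) : coneSnd v (p + 1) ((cone v).d p y) =
    -(X.t (Fin.last c) p (coneFst v p y) + X.d (p + 1) (coneSnd v p y)) :=
  rfl

theorem cone_d_inl (p : ℤ) (a : X.M p) : (cone v).d p (coneInl v p a) =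
    coneInl v (p + 1) (X.d p a) - coneInr v (p + 1) (X.t (Fin.last c) p a) := by
  rw [cone_eq v (p + 1) ((cone v).d p (coneInl v p a)), coneFst_d, coneSnd_d]
  simp [sub_eq_add_neg]

theorem cone_d_inr (p : ℤ) (b : X.M (p + 1)) : (cone v).d p (coneInr v p b) =
    f (Fin.last c) • coneInl v (p + 1) b - coneInr v (p + 1) (X.d (p + 1) b) := by
  rw [cone_eq v (p + 1) ((cone v).d p (coneInr v p b)), coneFst_d, coneSnd_d]
  simp [sub_eq_add_neg]

/-- The first component `a` of a cycle is a cycle of `X` modulo all the elements, so `a ≡ dw + f_c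
z` modulo the others. Subtracting the boundary of `(w, z)` leaves a cycle with zero first component
modulo `J`. Its second component is then killed by `f_c` modulo `J`, hence zero by regularity. -/
theorem exactModulo_cone (hf : RingTheory.Sequence.IsWeaklyRegular Q (List.ofFn f))
    (hX : ExactModulo (Ideal.span (Set.range f)) X.d) :
    ExactModulo (Ideal.span (Set.range fun k : Fin c => f k.castSucc)) (cone v).d := by
  rw [span_range_eq_sup] at hX
  set J := Ideal.span (Set.range fun k : Fin c => f k.castSucc) with hJ
  intro p y hy
  have h1 := Ideal.map_mem_smul_top (coneFst v (p + 1 + 1)) hy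
  rw [coneFst_d] at h1
  obtain ⟨w, hw⟩ := hX p (coneFst v (p + 1) y) (sub_mem_sup_span_singleton_smul_top
    (y := -coneSnd v (p + 1) y) (by simpa using h1))
  obtain ⟨z, hz⟩ := mem_sup_span_singleton_smul_top hw
  let y' : (cone v).M p := coneInl v p w + coneInr v p z
  have hFst : coneFst v (p + 1) (y - (cone v).d p y') ∈ J • (⊤ : Submodule Q (X.M (p + 1))) := by
    rw [map_sub, coneFst_d]
    simpa [y', sub_sub] using hz
  refine ⟨y', ?_⟩
  rw [cone_eq v (p + 1) (y - (cone v).d p y')]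
  refine add_mem (Ideal.map_mem_smul_top _ hFst) (Ideal.map_mem_smul_top _
    (mem_smul_top_of_smul_mem (mem_of_last_mul_mem hf) ?_))
  have h2 : (cone v).d (p + 1) (y - (cone v).d p y') ∈
      J • (⊤ : Submodule Q ((cone v).M (p + 1 + 1))) := by
    rw [map_sub, (cone v).d_d]
    exact sub_mem hy (Ideal.mem_span_range_smul_top_iff.2 ⟨_, rfl⟩)
  have h3 := sub_mem (Ideal.map_mem_smul_top (coneFst v (p + 1 + 1)) h2)
    (Ideal.map_mem_smul_top (X.d (p + 1)) hFst)
  rwa [coneFst_d, add_sub_cancel_left] at h3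

/-! ### The cohomology of the cone -/

variable {D : CochainComplex (ModuleCat.{u} Q) ℤ}

variable (D) in
/-- Composition with the projection from the cone. -/
def compFst : X.Cochain D →ₗ[Q] (cone v).Cochain D where
  toFun φ p q := φ p q ∘ₗ coneFst v p
  map_add' _ _ := rfl
  map_smul' _ _ := rfl

theorem compFst_apply (φ : X.Cochain D) (p q : ℤ) (y : (cone v).M p) :
    compFst v D φ p q y = φ p q (coneFst v p y) :=
  rfl

variable (D) in
/-- Restriction to the second summand of the cone, with alternating signs. -/
def compInr : (cone v).Cochain D →ₗ[Q] X.Cochain D :=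
  (X.shiftIndex D).symm.toLinearMap ∘ₗ
    -- The sign `(-1)^p` compensates for the differential `-d` on the second summand of the cone.
    { toFun := fun φ p q => p.negOnePow • (φ p q ∘ₗ coneInr v p)
      map_add' := fun φ ψ => by
        funext p q
        change p.negOnePow • ((φ p q + ψ p q) ∘ₗ coneInr v p) = _
        rw [LinearMap.add_comp, smul_add]
        rfl
      map_smul' := fun a φ => by
        funext p q
        change p.negOnePow • ((a • φ p q) ∘ₗ coneInr v p) = a • (p.negOnePow • (φ p q ∘ₗ coneInr v p))
        rw [LinearMap.smul_comp, smul_comm] }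

theorem compInr_apply (φ : (cone v).Cochain D) (p q : ℤ) (b : X.M (p + 1)) :
    compInr v D φ (p + 1) q b = p.negOnePow • φ p q (coneInr v p b) := by
  rw [compInr, LinearMap.comp_apply, LinearEquiv.coe_coe, shiftIndex_symm_apply]
  rfl

variable (hD : ∀ k q (x : D.X q), f k • x = 0)
include hD

theorem compFst_mem_cocycles {i : ℤ} (φ : X.Cochain D) (hφ : φ ∈ X.cocycles D i) :
    compFst v D φ ∈ (cone v).cocycles D i := by
  intro p q r h1 h2 y
  rw [compFst_apply, compFst_apply, hφ p q r h1 h2, coneFst_d, map_add, map_smul, hD, add_zero]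

theorem compFst_mem_boundaries {i : ℤ} (φ : X.Cochain D) (hφ : φ ∈ X.boundaries D i) :
    compFst v D φ ∈ (cone v).boundaries D i := by
  obtain ⟨h, hh⟩ := hφ
  refine ⟨compFst v D h, fun p q r h1 h2 y => ?_⟩
  rw [compFst_apply, compFst_apply, compFst_apply, hh p q r h1 h2, coneFst_d, map_add, map_smul,
    hD, add_zero]

theorem compInr_mem_cocycles {i j : ℤ} (hij : j + 1 = i) (φ : (cone v).Cochain D)
    (hφ : φ ∈ (cone v).cocycles D i) : compInr v D φ ∈ X.cocycles D j := by
  intro p q r h1 h2 b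
  obtain ⟨p, rfl⟩ : ∃ p', p = p' + 1 := ⟨p - 1, by ring⟩
  rw [compInr_apply, compInr_apply, Int.negOnePow_succ, Units.smul_def, map_zsmul,
    hφ p q r (by omega) h2, cone_d_inr, map_sub, map_smul, hD, zero_sub]
  simp [Units.smul_def]

theorem compInr_mem_boundaries {i j : ℤ} (hij : j + 1 = i) (φ : (cone v).Cochain D)
    (hφ : φ ∈ (cone v).boundaries D i) : compInr v D φ ∈ X.boundaries D j := by
  obtain ⟨h, hh⟩ := hφ
  refine ⟨compInr v D h, fun p q r h1 h2 b => ?_⟩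
  obtain ⟨p, rfl⟩ : ∃ p', p = p' + 1 := ⟨p - 1, by ring⟩
  rw [compInr_apply, compInr_apply, compInr_apply, Int.negOnePow_succ, hh p q r (by omega) h2,
    cone_d_inr, map_sub, map_smul, hD, zero_sub]
  simp only [Units.smul_def, map_zsmul, smul_add, Units.val_neg, neg_smul, smul_neg]

/-- A class that vanishes on the cone is in the image of the last operator. -/
theorem exists_chi_eq (hf : RingTheory.Sequence.IsWeaklyRegular Q (List.ofFn f)) {i j : ℤ}
    (hij : i + 2 = j) (φ : X.Cochain D) (hφ : φ ∈ X.cocycles D j)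
    (h0 : compFst v D φ ∈ (cone v).boundaries D j) :
    ∃ y, X.chi hf hD (Fin.last c) hij y = X.classOf φ hφ := by
  obtain ⟨h, hh⟩ := h0
  -- The null-homotopy on the cone has two parts. On the second summand the homotopy identity says
  -- that `g` is a cocycle; on the first it says that `φ` is `-g ∘ t_c` plus the boundary of the
  -- other part.
  let g : X.Cochain D := (X.shiftIndex D).symm fun p q => h p q ∘ₗ coneInr v p
  have hg : ∀ p q b, g (p + 1) q b = h p q (coneInr v p b) := fun p q b =>
    LinearMap.congr_fun (shiftIndex_symm_apply (fun p q => h p q ∘ₗ coneInr v p) p q) b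
  have hgZ : -g ∈ X.cocycles D i := by
    refine neg_mem fun p q r h1 h2 b => ?_
    obtain ⟨p, rfl⟩ : ∃ p', p = p' + 1 := ⟨p - 1, by ring⟩
    have h3 := hh p q r (by omega) h2 (coneInr v p b)
    rw [cone_d_inr, compFst_apply, coneFst_inr, map_zero, map_sub, map_smul, hD, zero_sub,
      ← sub_eq_add_neg] at h3
    rw [hg, hg]
    exact (sub_eq_zero.1 h3.symm)
  refine ⟨X.classOf (-g) hgZ, ?_⟩
  rw [chi_classOf, eq_comm, ← sub_eq_zero]
  change X.classOf (φ - X.compT (Fin.last c) (-g)) _ = 0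
  rw [classOf_eq_zero_iff]
  refine ⟨fun p q => h p q ∘ₗ coneInl v p, fun p q r h1 h2 a => ?_⟩
  have h3 := hh p q r h1 h2 (coneInl v p a)
  rw [cone_d_inl, compFst_apply, coneFst_inl, map_sub] at h3
  have h4 : X.compT (Fin.last c) (-g) p r a =
      -(h (p + 1) r (coneInr v (p + 1) (X.t (Fin.last c) p a))) := by
    rw [← hg]; rfl
  rw [Pi.sub_apply, Pi.sub_apply, LinearMap.sub_apply, h3, h4]
  simp only [LinearMap.comp_apply]
  abel

/-- A class on the cone that vanishes on the second summand comes from the first one. -/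
theorem exists_compFst_sub_mem {i j : ℤ} (hij : j + 1 = i) (φ : (cone v).Cochain D)
    (hφ : φ ∈ (cone v).cocycles D i) (h0 : compInr v D φ ∈ X.boundaries D j) :
    ∃ ψ ∈ X.cocycles D i, φ - compFst v D ψ ∈ (cone v).boundaries D i := by
  obtain ⟨h, hh⟩ := h0
  -- The homotopy on the second summand, extended by zero to the cone. Subtracting its boundary
  -- makes the cocycle vanish on the second summand, so that it factors through the first.
  let g : (cone v).Cochain D := fun p q => p.negOnePow • (h (p + 1) q ∘ₗ coneSnd v p)
  have hg : ∀ p q y, g p q y = p.negOnePow • h (p + 1) q (coneSnd v p y) := fun p q b => rfl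
  let b : (cone v).Cochain D := fun p r =>
    (D.d (r - 1) r).hom ∘ₗ g p (r - 1) + g (p + 1) r ∘ₗ (cone v).d p
  have hb : ∀ p q r, q + 1 = r → ∀ y,
      b p r y = (D.d q r).hom (g p q y) + g (p + 1) r ((cone v).d p y) := by
    rintro p q r h2 y
    obtain rfl : q = r - 1 := by omega
    rfl
  have hbB : b ∈ (cone v).boundaries D i := ⟨g, fun p q r _ h2 y => hb p q r h2 y⟩
  have hbZ : φ - b ∈ (cone v).cocycles D i :=
    sub_mem hφ (boundaries_le_cocycles (fun k q x => hD k.castSucc q x) i hbB)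
  have hInr : ∀ p q, p + i = q → ∀ x, (φ - b) p q (coneInr v p x) = 0 := by
    intro p r h1 x
    have h3 := hh (p + 1) (r - 1) r (by omega) (by ring) x
    rw [compInr_apply] at h3
    have h4 : φ p r (coneInr v p x) = p.negOnePow • ((D.d (r - 1) r).hom (h (p + 1) (r - 1) x) +
        h (p + 1 + 1) r (X.d (p + 1) x)) := by
      rw [← h3, smul_smul]
      simp
    have h5 := hb p (r - 1) r (by ring) (coneInr v p x)
    rw [hg, hg, coneSnd_inr, coneSnd_d, coneFst_inr, coneSnd_inr, map_zero, zero_add] at h5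
    rw [Pi.sub_apply, Pi.sub_apply, LinearMap.sub_apply, h4, h5]
    simp [Units.smul_def, Int.negOnePow_succ, smul_add]
  let ψ : X.Cochain D := fun p q => (φ - b) p q ∘ₗ coneInl v p
  have hψ : ∀ p q, p + i = q → ∀ y, (φ - b) p q y = ψ p q (coneFst v p y) := by
    intro p q h1 y
    conv_lhs => rw [cone_eq v p y]
    rw [map_add, hInr p q h1, add_zero]
    rfl
  refine ⟨ψ, fun p q r h1 h2 x => ?_, 
    ⟨g, fun p q r h1 h2 y => ?_⟩⟩
  · have h3 := hbZ p q r h1 h2 (coneInl v p x)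
    rw [hψ p q h1, hψ (p + 1) r (by omega), coneFst_d, coneFst_inl, coneSnd_inl, smul_zero,
      add_zero] at h3
    exact h3
  · have h3 := hψ p r h1 y
    rw [Pi.sub_apply, Pi.sub_apply, LinearMap.sub_apply] at h3
    rw [Pi.sub_apply, Pi.sub_apply, LinearMap.sub_apply, compFst_apply, ← h3, ← hb p q r h2]
    abel

/-- The maps `α` and `β` form a piece of the long exact sequence of the cone, exact in the middle,
with Noetherian ends. -/
theorem finite_cohomology_cone [IsNoetherianRing Q] (h : ∀ i, Module.Finite Q (X.Cohomology D i))
    (i : ℤ) : Module.Finite Q ((cone v).Cohomology D i) := by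
  let α : X.Cohomology D i →ₗ[Q] (cone v).Cohomology D i :=
    cohomologyMap (compFst v D) (compFst_mem_cocycles v hD) (compFst_mem_boundaries v hD)
  let β : (cone v).Cohomology D i →ₗ[Q] X.Cohomology D (i - 1) :=
    cohomologyMap (compInr v D) (compInr_mem_cocycles v hD (by ring))
      (compInr_mem_boundaries v hD (by ring))
  have := isNoetherian_of_isNoetherianRing_of_finite Q (X.Cohomology D i)
  have := isNoetherian_of_isNoetherianRing_of_finite Q (X.Cohomology D (i - 1))
  have : IsNoetherian Q ((cone v).Cohomology D i) := by
    refine isNoetherian_of_range_eq_ker α β (le_antisymm ?_ fun x hx => ?_)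
    · rintro _ ⟨x, rfl⟩
      obtain ⟨φ, hφ, rfl⟩ := exists_classOf_eq x
      rw [LinearMap.mem_ker]
      refine (classOf_eq_zero_iff (compInr_mem_cocycles v hD (show i - 1 + 1 = i by ring) _
        (compFst_mem_cocycles v hD φ hφ))).2 ⟨0, fun p q r h1 h2 b => ?_⟩
      obtain ⟨p, rfl⟩ : ∃ p', p = p' + 1 := ⟨p - 1, by ring⟩
      rw [compInr_apply, compFst_apply, coneFst_inr, map_zero, smul_zero]
      simp
    · obtain ⟨φ, hφ, rfl⟩ := exists_classOf_eq x
      rw [LinearMap.mem_ker] at hx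
      obtain ⟨ψ, hψ, hb⟩ := exists_compFst_sub_mem v hD (show i - 1 + 1 = i by ring) φ hφ
        ((classOf_eq_zero_iff _).1 hx)
      refine ⟨X.classOf ψ hψ, ?_⟩
      rw [eq_comm, ← sub_eq_zero]
      exact (classOf_eq_zero_iff (sub_mem hφ (compFst_mem_cocycles v hD ψ hψ))).2 hb
  infer_instance

end Cone

/-! ### Eventual generation, by induction on the number of elements. -/

section Generation

variable {D : CochainComplex (ModuleCat.{u} Q) ℤ}

/-- The cohomology of a contractible curved complex vanishes. -/
theorem mem_boundaries_of_contraction {f : Fin c → Q} {X : CurvedComplex f}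
    (s : ∀ p, X.M (p + 1) →ₗ[Q] X.M p)
    (hs : ∀ p x, X.d p (s p x) + s (p + 1) (X.d (p + 1) x) = x) {i : ℤ} {φ : X.Cochain D}
    (hφ : φ ∈ X.cocycles D i) : φ ∈ X.boundaries D i := by
  have hs' : ∀ p q b, (X.shiftIndex D).symm (fun p q => φ p q ∘ₗ s p) (p + 1) q b =
      φ p q (s p b) := fun p q b => by rw [shiftIndex_symm_apply]; rfl
  refine ⟨(X.shiftIndex D).symm fun p q => φ p q ∘ₗ s p, fun p q r h1 h2 x => ?_⟩
  obtain ⟨p, rfl⟩ : ∃ p', p = p' + 1 := ⟨p - 1, by ring⟩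
  rw [hs', hs', hφ p q r (by omega) h2, ← map_add, hs]

/-- Over a regular local ring, the cohomology of an exact curved complex is eventually generated
by the operators `χ_k`. -/
theorem eventuallyGenerated [IsRegularLocalRing Q] (f : Fin c → Q)
    (hf : RingTheory.Sequence.IsWeaklyRegular Q (List.ofFn f)) (X : CurvedComplex f)
    (hX : ExactModulo (Ideal.span (Set.range f)) X.d) (hD : ∀ k q (x : D.X q), f k • x = 0)
    (hfin : ∀ i, Module.Finite Q (X.Cohomology D i)) :
    EventuallyGenerated (H := fun n : ℕ => X.Cohomology D n)
      fun k n => X.chi hf hD k (show (n : ℤ) + 2 = ((n + 2 : ℕ) : ℤ) by push_cast; rfl) := by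
  induction c with
  | zero =>
    refine ⟨0, fun i _ x => ⟨0, ?_⟩⟩
    have hbot : Ideal.span (Set.range f) = ⊥ := by
      rw [Set.range_eq_empty, Ideal.span_empty]
    rw [hbot] at hX
    -- With no elements `f_k` the curvature is zero, and the complex is exact modulo the zero ideal.
    obtain ⟨s, hs⟩ := hX.exists_contraction fun p x => by rw [X.d_d]; simp
    obtain ⟨φ, hφ, rfl⟩ := exists_classOf_eq x
    rw [(classOf_eq_zero_iff hφ).2 (mem_boundaries_of_contraction s hs hφ)]
    simp
  | succ c ih =>
    obtain ⟨v⟩ := X.nonempty_commutatorLift hf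
    have hD' : ∀ (k : Fin c) q (x : D.X q), f k.castSucc • x = 0 := fun k q x => hD _ q x
    have hfin' := finite_cohomology_cone v hD hfin
    refine EventuallyGenerated.of_ker_le_range (H' := fun n : ℕ => (cone v).Cohomology D n) _ _
      (fun j k i x => chi_comm _ _ _ _ _ _ _)
      (ih _ (isWeaklyRegular_castSucc hf) (cone v) (exactModulo_cone v hf hX) hD' hfin')
      (fun n => cohomologyMap (compFst v D) (compFst_mem_cocycles v hD)
        (compFst_mem_boundaries v hD)) (fun k i x => ?_) (fun i x hx => ?_)
    · obtain ⟨φ, hφ, rfl⟩ := exists_classOf_eq x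
      rfl
    · obtain ⟨φ, hφ, rfl⟩ := exists_classOf_eq x
      exact exists_chi_eq v hD hf _ φ hφ ((classOf_eq_zero_iff _).1 hx)

end Generation

end CurvedComplex

/-! ### The curved complex of a lift, and its reduction to `C`. -/

namespace TotallyAcyclic

/-- A complex over `R`, regarded as a complex over `Q`. -/
noncomputable abbrev restrictComplex {Q R : Type u} [CommRing Q] [CommRing R] (π : Q →+* R)
    (D : CochainComplex (ModuleCat.{u} R) ℤ) : CochainComplex (ModuleCat.{u} Q) ℤ :=
  ((ModuleCat.restrictScalars π).mapHomologicalComplex _).obj D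

variable {Q : Type u} [CommRing Q] {c : ℕ} {f : Fin c → Q}

/-- Complexes over `Q/(f₁, …, f_c)` regarded as complexes over `Q`. -/
noncomputable abbrev overQ (D : CochainComplex (ModuleCat.{u} (QuotRing f)) ℤ) :
    CochainComplex (ModuleCat.{u} Q) ℤ :=
  restrictComplex (Ideal.Quotient.mk (Ideal.span (Set.range f))) D

theorem smul_overQ_eq_zero (D : CochainComplex (ModuleCat.{u} (QuotRing f)) ℤ) (k : Fin c) (q : ℤ)
    (x : (overQ D).X q) : f k • x = 0 := by
  have h : Ideal.Quotient.mk (Ideal.span (Set.range f)) (f k) = 0 :=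
    Ideal.Quotient.eq_zero_iff_mem.2 (Ideal.subset_span ⟨k, rfl⟩)
  change (Ideal.Quotient.mk (Ideal.span (Set.range f)) (f k) • (show D.X q from x) : D.X q) = 0
  rw [h]
  exact zero_smul (QuotRing f) (A := D.X q) x

theorem exists_of_acyclic {R : Type u} [CommRing R] {C : CochainComplex (ModuleCat.{u} R) ℤ}
    (hC : C.Acyclic) {p q r : ℤ} (h1 : p + 1 = q) (h2 : q + 1 = r) (x : C.X q)
    (hx : (C.d q r).hom x = 0) : ∃ y, (C.d p q).hom y = x := by
  have h := hC q
  rw [C.exactAt_iff' p q r (by simp; omega) (by simp; omega),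
    ShortComplex.moduleCat_exact_iff] at h
  exact h x hx

/-- Linear maps from a term of a totally acyclic complex to a finitely generated free module that
vanish on boundaries extend to the next term. -/
theorem Ktac.exists_extension {R : Type u} [CommRing R] (C : Ktac R) {V : Type*} [AddCommGroup V]
    [Module R V] [Module.Free R V] [Module.Finite R V] {p q r : ℤ} (h1 : p + 1 = q)
    (h2 : q + 1 = r) (g : C.X.X q →ₗ[R] V) (hg : g ∘ₗ (C.X.d p q).hom = 0) :
    ∃ g' : C.X.X r →ₗ[R] V, g' ∘ₗ (C.X.d q r).hom = g := by
  subst h1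
  obtain rfl : r = p + 2 := by omega
  let b := Module.Free.chooseBasis R V
  have h : ∀ j, ∃ g' : C.X.X (p + 2) →ₗ[R] R,
      (C.X.d (p + 1) (p + 2)).hom.dualMap g' = b.coord j ∘ₗ g := fun j => by
    refine (C.exact_dual p (b.coord j ∘ₗ g)).1 ?_
    rw [LinearMap.dualMap_apply', LinearMap.comp_assoc, hg, LinearMap.comp_zero]
  choose g' hg' using h
  refine ⟨∑ j, (g' j).smulRight (b j), LinearMap.ext fun x => b.ext_elem fun i => ?_⟩
  have h3 := LinearMap.congr_fun (hg' i) x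
  simp only [LinearMap.dualMap_apply, LinearMap.comp_apply, Module.Basis.coord_apply] at h3
  simp [Finsupp.single_apply, h3]

namespace Lift

variable {C D : CochainComplex (ModuleCat.{u} (QuotRing f)) ℤ} (L : Lift f C)

theorem d_mul_d' (p n : ℤ) (h : n = p + 2) :
    L.d (p + 1) n * L.d p (p + 1) = ∑ k, f k • L.t k p n := by
  subst h
  exact L.d_mul_d p

/-- The curved complex given by a lift. -/
noncomputable def toCurved : CurvedComplex f where
  M p := Fin (L.rank p) → Q
  d p := (L.d p (p + 1)).mulVecLin
  t k p := (L.t k p (p + 1 + 1)).mulVecLin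
  d_d p x := by
    rw [Matrix.mulVecLin_apply, Matrix.mulVecLin_apply, Matrix.mulVec_mulVec,
      L.d_mul_d' p (p + 1 + 1) (by ring), Matrix.sum_mulVec]
    simp [Matrix.smul_mulVec]

/-- Reduction modulo `(f₁, …, f_c)`. -/
noncomputable def proj (p : ℤ) :
    L.toCurved.M p →ₛₗ[Ideal.Quotient.mk (Ideal.span (Set.range f))] C.X p where
  toFun v := (L.basis p).equivFun.symm fun j => Ideal.Quotient.mk _ ((v : Fin (L.rank p) → Q) j)
  map_add' v w := by
    rw [← map_add]
    exact congrArg _ (funext fun j => map_add _ _ _)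
  map_smul' a v := by
    rw [← map_smul]
    exact congrArg _ (funext fun j => map_mul _ _ _)

/-- The standard basis of the curved complex given by a lift. -/
noncomputable def curvedBasis (p : ℤ) : Module.Basis (Fin (L.rank p)) Q (L.toCurved.M p) :=
  Pi.basisFun Q (Fin (L.rank p))

theorem equivFun_proj (p : ℤ) (v : Fin (L.rank p) → Q) :
    (L.basis p).equivFun (L.proj p v) = fun j => Ideal.Quotient.mk _ (v j) :=
  (L.basis p).equivFun.apply_symm_apply _

theorem repr_proj (p : ℤ) (v : L.toCurved.M p) (j : Fin (L.rank p)) :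
    (L.basis p).repr (L.proj p v) j = Ideal.Quotient.mk _ ((L.curvedBasis p).repr v j) :=
  congrFun (L.equivFun_proj p v) j

theorem proj_basis (p : ℤ) (j : Fin (L.rank p)) :
    L.proj p (L.curvedBasis p j) = L.basis p j := by
  apply (L.basis p).repr.injective
  ext i
  rw [repr_proj, Module.Basis.repr_self, Module.Basis.repr_self, Finsupp.single_apply,
    Finsupp.single_apply]
  split_ifs <;> simp

theorem proj_surjective (p : ℤ) : Function.Surjective (L.proj p) := by
  intro x
  choose v hv using fun j => Ideal.Quotient.mk_surjective ((L.basis p).equivFun x j)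
  refine ⟨v, (L.basis p).equivFun.injective ?_⟩
  rw [equivFun_proj]
  exact funext hv

theorem proj_eq_zero_iff (p : ℤ) (v : L.toCurved.M p) : L.proj p v = 0 ↔
    v ∈ Ideal.span (Set.range f) • (⊤ : Submodule Q (L.toCurved.M p)) := by
  rw [Ideal.mem_smul_top_iff_repr (L.curvedBasis p), ← (L.basis p).equivFun.map_eq_zero_iff]
  refine funext_iff.trans (forall_congr' fun j => ?_)
  rw [Module.Basis.equivFun_apply, repr_proj, ← Ideal.Quotient.eq_zero_iff_mem]
  rfl

theorem toLin_proj {p q : ℤ} (A : Matrix (Fin (L.rank q)) (Fin (L.rank p)) Q)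
    (v : Fin (L.rank p) → Q) :
    Matrix.toLin (L.basis p) (L.basis q) (red f A) (L.proj p v) = L.proj q (A.mulVec v) := by
  apply (L.basis q).equivFun.injective
  rw [equivFun_proj]
  have h1 : (L.basis q).equivFun (Matrix.toLin (L.basis p) (L.basis q) (red f A) (L.proj p v)) =
      (red f A).mulVec ((L.basis p).equivFun (L.proj p v)) := by
    have := LinearMap.toMatrix_mulVec_repr (L.basis p) (L.basis q)
      (Matrix.toLin (L.basis p) (L.basis q) (red f A)) (L.proj p v)
    rw [LinearMap.toMatrix_toLin] at this
    exact this.symm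
  rw [h1, equivFun_proj]
  funext j
  simp [Matrix.mulVec, dotProduct]

theorem proj_d (p : ℤ) (v : L.toCurved.M p) :
    L.proj (p + 1) (L.toCurved.d p v) = (C.d p (p + 1)).hom (L.proj p v) := by
  refine (L.toLin_proj (L.d p (p + 1)) v).symm.trans ?_
  rw [red_d, Matrix.toLin_toMatrix]

theorem proj_t (k : Fin c) (p : ℤ) (v : L.toCurved.M p) :
    L.proj (p + 1 + 1) (L.toCurved.t k p v) = L.op k p (p + 1 + 1) (L.proj p v) :=
  (L.toLin_proj (L.t k p (p + 1 + 1)) v).symm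

theorem exactModulo_toCurved (hC : C.Acyclic) :
    ExactModulo (Ideal.span (Set.range f)) L.toCurved.d := by
  intro p x hx
  rw [← proj_eq_zero_iff, proj_d] at hx
  obtain ⟨y, hy⟩ := exists_of_acyclic hC rfl rfl _ hx
  obtain ⟨w, rfl⟩ := L.proj_surjective p y
  refine ⟨w, ?_⟩
  rw [← proj_eq_zero_iff, map_sub, proj_d, hy, sub_self]

/-- The `R`-linear map induced by a `Q`-linear map to an `R`-module. -/
noncomputable def descend {p q : ℤ} (φ : L.toCurved.M p →ₗ[Q] (overQ D).X q) :
    C.X p →ₗ[QuotRing f] D.X q :=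
  (L.basis p).constr (QuotRing f) fun j => φ (L.curvedBasis p j)

/-- The `Q`-linear map given by an `R`-linear map. -/
noncomputable def ascend {p q : ℤ} (g : C.X p →ₗ[QuotRing f] D.X q) :
    L.toCurved.M p →ₗ[Q] (overQ D).X q where
  toFun v := g (L.proj p v)
  map_add' v w := by rw [map_add, map_add]; rfl
  map_smul' a v := by rw [LinearMap.map_smulₛₗ, map_smul]; rfl

theorem ascend_apply {p q : ℤ} (g : C.X p →ₗ[QuotRing f] D.X q) (v : L.toCurved.M p) :
    L.ascend g v = g (L.proj p v) :=
  rfl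

theorem ascend_descend {p q : ℤ} (φ : L.toCurved.M p →ₗ[Q] (overQ D).X q) :
    L.ascend (L.descend φ) = φ := by
  apply (L.curvedBasis p).ext
  intro j
  rw [ascend_apply, proj_basis]
  exact (L.basis p).constr_basis (M' := D.X q) (QuotRing f) (fun j => φ (L.curvedBasis p j)) j

theorem descend_proj {p q : ℤ} (φ : L.toCurved.M p →ₗ[Q] (overQ D).X q) (v : L.toCurved.M p) :
    L.descend φ (L.proj p v) = φ v :=
  LinearMap.congr_fun (L.ascend_descend φ) v

theorem eq_descend {p q : ℤ} {φ : L.toCurved.M p →ₗ[Q] (overQ D).X q}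
    {g : C.X p →ₗ[QuotRing f] D.X q} (h : ∀ v, g (L.proj p v) = φ v) : L.descend φ = g := by
  ext x
  obtain ⟨v, rfl⟩ := L.proj_surjective p x
  rw [descend_proj, h]

end Lift

end TotallyAcyclic

/-! ### Finiteness of the cohomology in each degree. -/

/-- Two-sided dependent choice along the integers. -/
theorem Int.exists_family {T : ℤ → Type*} (Rel : ∀ p, T p → T (p + 1) → Prop)
    (P : ∀ p, T p → Prop) {x₀ : T 0} (h₀ : P 0 x₀)
    (hr : ∀ p x, P p x → ∃ y, Rel p x y ∧ P (p + 1) y)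
    (hl : ∀ p y, P (p + 1) y → ∃ x, Rel p x y ∧ P p x) :
    ∃ h : ∀ p, T p, ∀ p, Rel p (h p) (h (p + 1)) := by
  choose r hr1 hr2 using hr
  choose l hl1 hl2 using hl
  let R : ∀ n : ℕ, {x : T (Int.ofNat n) // P _ x} := fun n =>
    Nat.rec ⟨x₀, h₀⟩ (fun n x => ⟨r (Int.ofNat n) x.1 x.2, hr2 _ _ x.2⟩) n
  let S : ∀ n : ℕ, {x : T (Int.negSucc n) // P _ x} := fun n =>
    Nat.rec ⟨l (Int.negSucc 0) x₀ h₀, hl2 (Int.negSucc 0) _ h₀⟩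
      (fun n x => ⟨l (Int.negSucc (n + 1)) x.1 x.2, hl2 (Int.negSucc (n + 1)) _ x.2⟩) n
  refine ⟨fun p => match p with
    | Int.ofNat n => (R n).1
    | Int.negSucc n => (S n).1, fun p => ?_⟩
  match p with
  | Int.ofNat n => exact hr1 (Int.ofNat n) _ (R n).2
  | Int.negSucc 0 => exact hl1 (Int.negSucc 0) x₀ h₀
  | Int.negSucc (n + 1) => exact hl1 (Int.negSucc (n + 1)) _ (S n).2

namespace TotallyAcyclic

variable {Q : Type u} [CommRing Q] {c : ℕ} {f : Fin c → Q}

namespace Lift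

section Finite

variable {C D : Ktac (QuotRing f)} (L : Lift f C.X)

/-- Here exactness of the dual of `C` enters: a map that kills the cycles modulo `(f)` kills
boundaries in particular, so it factors through the differential. -/
theorem exists_extension_d {p r : ℤ} (ψ : L.toCurved.M p →ₗ[Q] (overQ D.X).X r)
    (hψ : ∀ v, L.toCurved.d p v ∈
      Ideal.span (Set.range f) • (⊤ : Submodule Q (L.toCurved.M (p + 1))) → ψ v = 0) :
    ∃ y : L.toCurved.M (p + 1) →ₗ[Q] (overQ D.X).X r, ∀ v, y (L.toCurved.d p v) = ψ v := by
  have := D.free r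
  have := D.finite r
  obtain ⟨g, hg⟩ := C.exists_extension (show p - 1 + 1 = p by ring) rfl (L.descend ψ) (by
    ext z
    obtain ⟨v, hv⟩ := L.proj_surjective p ((C.X.d (p - 1) p).hom z)
    rw [LinearMap.comp_apply, ← hv, descend_proj]
    apply hψ
    rw [← proj_eq_zero_iff, proj_d, hv, ← LinearMap.comp_apply, ← ModuleCat.hom_comp,
      C.X.d_comp_d]
    rfl)
  refine ⟨L.ascend g, fun v => ?_⟩
  rw [ascend_apply, proj_d, ← LinearMap.comp_apply, hg, descend_proj]

theorem exists_lift_d {p q r s : ℤ} (h1 : q + 1 = r) (h2 : r + 1 = s)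
    (ψ : L.toCurved.M p →ₗ[Q] (overQ D.X).X r)
    (hψ : ∀ v, ((overQ D.X).d r s).hom (ψ v) = 0) :
    ∃ x : L.toCurved.M p →ₗ[Q] (overQ D.X).X q, ∀ v, ((overQ D.X).d q r).hom (x v) = ψ v := by
  have h : ∀ j, ∃ y : (overQ D.X).X q, ((overQ D.X).d q r).hom y = ψ (L.curvedBasis p j) :=
    fun j => exists_of_acyclic D.exact h1 h2 (ψ (L.curvedBasis p j)) (hψ _)
  choose y hy using h
  refine ⟨(L.curvedBasis p).constr Q y, fun v => ?_⟩
  rw [← LinearMap.comp_apply]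
  refine LinearMap.congr_fun ((L.curvedBasis p).ext fun j => ?_) v
  rw [LinearMap.comp_apply, Module.Basis.constr_basis]
  exact hy j

/-- A cocycle whose component at one index vanishes is a boundary. -/
theorem mem_boundaries_of_apply_zero {i : ℤ} {φ : L.toCurved.Cochain (overQ D.X)}
    (hφ : φ ∈ L.toCurved.cocycles (overQ D.X) i) (h0 : φ 0 i = 0) :
    φ ∈ L.toCurved.boundaries (overQ D.X) i := by
  have hexact := L.exactModulo_toCurved C.exact
  have hdd : ∀ q r s (x : (overQ D.X).X q),
      ((overQ D.X).d r s).hom (((overQ D.X).d q r).hom x) = 0 := fun q r s x => by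
    rw [← LinearMap.comp_apply, ← ModuleCat.hom_comp, (overQ D.X).d_comp_d]
    rfl
  have hkill : ∀ {p q} (ψ : L.toCurved.M p →ₗ[Q] (overQ D.X).X q) {x},
      x ∈ Ideal.span (Set.range f) • (⊤ : Submodule Q (L.toCurved.M p)) → ψ x = 0 :=
    fun ψ _ hx => CurvedComplex.apply_eq_zero (smul_overQ_eq_zero D.X) ψ hx
  have hddI : ∀ p v, L.toCurved.d (p + 1) (L.toCurved.d p v) ∈
      Ideal.span (Set.range f) • (⊤ : Submodule Q (L.toCurved.M (p + 1 + 1))) := fun p v => by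
    rw [L.toCurved.d_d]
    exact Ideal.mem_span_range_smul_top_iff.2 ⟨_, rfl⟩
  let T : ℤ → Type u := fun p => ∀ q, L.toCurved.M p →ₗ[Q] (overQ D.X).X q
  -- `Rel` is the homotopy identity at index `p`. `P` is its restriction to cycles modulo `(f)`,
  -- where the term with `y` disappears; it is the condition under which the homotopy extends one
  -- step in either direction. The zero map satisfies it at index `0` because `φ` vanishes there.
  let Rel : ∀ p, T p → T (p + 1) → Prop := fun p x y => ∀ q r, p + i = r → q + 1 = r → ∀ v,
    φ p r v = ((overQ D.X).d q r).hom (x q v) + y r (L.toCurved.d p v)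
  let P : ∀ p, T p → Prop := fun p x => ∀ q r, p + i = r → q + 1 = r → ∀ v,
    L.toCurved.d p v ∈ Ideal.span (Set.range f) • (⊤ : Submodule Q (L.toCurved.M (p + 1))) →
      φ p r v = ((overQ D.X).d q r).hom (x q v)
  obtain ⟨h, hh⟩ := Int.exists_family Rel P (x₀ := 0) (by
    intro q r h1 _ v _
    obtain rfl : r = i := by omega
    rw [h0]
    exact (map_zero _).symm) (by
    intro p x hx
    have : ∀ r, ∃ y : L.toCurved.M (p + 1) →ₗ[Q] (overQ D.X).X r, ∀ q, p + i = r → q + 1 = r →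
        ∀ v, φ p r v = ((overQ D.X).d q r).hom (x q v) + y (L.toCurved.d p v) := by
      intro r
      by_cases hr : p + i = r
      · obtain ⟨y, hy⟩ := L.exists_extension_d
          (φ p r - ((overQ D.X).d (r - 1) r).hom ∘ₗ x (r - 1)) (fun v hv => by
            rw [LinearMap.sub_apply, LinearMap.comp_apply, hx (r - 1) r hr (by ring) v hv, sub_self])
        refine ⟨y, fun q _ hq v => ?_⟩
        obtain rfl : q = r - 1 := by omega
        rw [hy, LinearMap.sub_apply, LinearMap.comp_apply]
        abel
      · exact ⟨0, fun q h => absurd h hr⟩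
    choose y hy using this
    have hRel : Rel p x y := fun q r h1 h2 v => hy r q h1 h2 v
    refine ⟨y, hRel, fun q r h1 h2 v hv => ?_⟩
    obtain ⟨w, hw⟩ := hexact p v hv
    have e1 : φ (p + 1) r v = φ (p + 1) r (L.toCurved.d p w) := by
      rw [← sub_eq_zero, ← map_sub, hkill _ hw]
    have e2 : y q v = y q (L.toCurved.d p w) := by
      rw [← sub_eq_zero, ← map_sub, hkill _ hw]
    rw [e1, e2, ← hφ p q r (by omega) h2, hRel (q - 1) q (by omega) (by ring), map_add, hdd,
      zero_add]) (by
    intro p y hy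
    have : ∀ q, ∃ x : L.toCurved.M p →ₗ[Q] (overQ D.X).X q, ∀ r, p + i = r → q + 1 = r →
        ∀ v, φ p r v = ((overQ D.X).d q r).hom (x v) + y r (L.toCurved.d p v) := by
      intro q
      by_cases hr : p + i = q + 1
      · obtain ⟨x, hx⟩ := L.exists_lift_d (s := q + 1 + 1) (q := q) rfl rfl
          (φ p (q + 1) - y (q + 1) ∘ₗ L.toCurved.d p) (fun v => by
            rw [LinearMap.sub_apply, LinearMap.comp_apply, map_sub,
              hφ p (q + 1) (q + 1 + 1) hr rfl,
              hy (q + 1) (q + 1 + 1) (by omega) rfl _ (hddI p v), sub_self])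
        refine ⟨x, fun r _ hq v => ?_⟩
        subst hq
        rw [hx, LinearMap.sub_apply, LinearMap.comp_apply]
        abel
      · exact ⟨0, fun r h h' => absurd (h.trans h'.symm) hr⟩
    choose x hx using this
    have hRel : Rel p x y := fun q r h1 h2 v => hx q r h1 h2 v
    refine ⟨x, hRel, fun q r h1 h2 v hv => ?_⟩
    rw [hRel q r h1 h2, hkill _ hv, add_zero])
  exact ⟨h, fun p q r h1 h2 v => hh p q r h1 h2 v⟩

/-- Cocycles whose component at index `0` vanishes are boundaries, so the cohomology is a quotient
of a submodule of the Noetherian module `Hom_Q(M^0, D^i)`. -/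
theorem finite_cohomology [IsNoetherianRing Q] (i : ℤ) :
    Module.Finite Q (L.toCurved.Cohomology (overQ D.X) i) := by
  let ev : L.toCurved.cocycles (overQ D.X) i →ₗ[Q] (L.toCurved.M 0 →ₗ[Q] (overQ D.X).X i) :=
    { toFun := fun φ => φ.1 0 i
      map_add' := fun _ _ => rfl
      map_smul' := fun _ _ => rfl }
  have hker : LinearMap.ker ev ≤
      (L.toCurved.boundaries (overQ D.X) i).submoduleOf (L.toCurved.cocycles (overQ D.X) i) :=
    fun φ hφ => L.mem_boundaries_of_apply_zero φ.2 hφ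
  have : Module.Finite Q ((overQ D.X).X i) := by
    obtain ⟨S, hS⟩ := (D.finite i).fg_top
    let S' : Finset ((overQ D.X).X i) := S
    let N : Submodule (QuotRing f) (D.X.X i) :=
      { carrier := {x | x ∈ Submodule.span Q (S' : Set ((overQ D.X).X i))}
        add_mem' := fun hx hy => (Submodule.span Q (S' : Set ((overQ D.X).X i))).add_mem hx hy
        zero_mem' := zero_mem (Submodule.span Q (S' : Set ((overQ D.X).X i)))
        smul_mem' := fun a x hx => by
          obtain ⟨a, rfl⟩ := Ideal.Quotient.mk_surjective a
          exact Submodule.smul_mem (Submodule.span Q (S' : Set ((overQ D.X).X i))) a hx }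
    have hN : N = ⊤ := by
      rw [eq_top_iff, ← hS, Submodule.span_le]
      exact fun x hx => Submodule.subset_span (R := Q) (M := (overQ D.X).X i) hx
    have hmem : ∀ x : D.X.X i, x ∈ N := fun x => hN ▸ Submodule.mem_top
    exact ⟨⟨S', eq_top_iff.2 fun x _ => hmem x⟩⟩
  have : IsNoetherian Q (L.toCurved.M 0 →ₗ[Q] (overQ D.X).X i) := by infer_instance
  have : Module.Finite Q (L.toCurved.cocycles (overQ D.X) i ⧸ LinearMap.ker ev) :=
    Module.Finite.equiv ev.quotKerEquivRange.symm
  exact Module.Finite.of_surjective (Submodule.factor hker) (Submodule.factor_surjective hker)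

end Finite

end Lift

end TotallyAcyclic

/-! ### Cocycles and homotopy classes of chain maps to shifts. -/

theorem Int.negOnePow_smul_smul {V : Type*} [AddCommGroup V] (n : ℤ) (y : V) :
    n.negOnePow • n.negOnePow • y = y := by
  rw [smul_smul]; simp

theorem LinearMap.map_negOnePow_smul {R V W : Type*} [Ring R] [AddCommGroup V] [Module R V]
    [AddCommGroup W] [Module R W] (g : V →ₗ[R] W) (n : ℤ) (y : V) :
    g (n.negOnePow • y) = n.negOnePow • g y := by
  rw [Units.smul_def, Units.smul_def, map_zsmul]

namespace TotallyAcyclic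

variable {Q : Type u} [CommRing Q] {c : ℕ} {f : Fin c → Q}

namespace Lift

variable {C D : CochainComplex (ModuleCat.{u} (QuotRing f)) ℤ} (L : Lift f C)

theorem descend_add {p q : ℤ} (φ ψ : L.toCurved.M p →ₗ[Q] (overQ D).X q) :
    L.descend (φ + ψ) = L.descend φ + L.descend ψ :=
  L.eq_descend fun v => by
    rw [LinearMap.add_apply, descend_proj, descend_proj]
    rfl

theorem descend_smul {p q : ℤ} (a : Q) (φ : L.toCurved.M p →ₗ[Q] (overQ D).X q) :
    L.descend (a • φ) = Ideal.Quotient.mk (Ideal.span (Set.range f)) a • L.descend φ :=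
  L.eq_descend fun v => by
    rw [LinearMap.smul_apply, descend_proj]
    rfl

/-- The chain map `C → Σ^i D` given by a cocycle of degree `i`. Cocycles commute with the
differentials without sign, hence the twist. -/
noncomputable def cocycleMap {i : ℤ} (φ : L.toCurved.Cochain (overQ D))
    (hφ : φ ∈ L.toCurved.cocycles (overQ D) i) : C ⟶ D⟦i⟧ where
  f p := ModuleCat.ofHom ((i * p).negOnePow • L.descend (φ p (p + i)))
  comm' := by
    rintro p _ (rfl : p + 1 = _)
    rw [CochainComplex.shiftFunctor_obj_d']
    apply ModuleCat.hom_ext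
    ext x
    obtain ⟨v, rfl⟩ := L.proj_surjective p x
    have h := hφ p (p + i) (p + 1 + i) rfl (by ring) v
    have e1 : L.descend (φ (p + 1) (p + 1 + i)) ((C.d p (p + 1)).hom (L.proj p v)) =
        (D.d (p + i) (p + 1 + i)).hom (L.descend (φ p (p + i)) (L.proj p v)) := by
      rw [← proj_d, descend_proj, descend_proj]
      exact h.symm
    have e2 : (i * (p + 1)).negOnePow = i.negOnePow * (i * p).negOnePow := by
      rw [← Int.negOnePow_add]; congr 1; ring
    change i.negOnePow • (D.d (p + i) (p + 1 + i)).hom ((i * p).negOnePow •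
      L.descend (φ p (p + i)) (L.proj p v)) = (i * (p + 1)).negOnePow •
        L.descend (φ (p + 1) (p + 1 + i)) ((C.d p (p + 1)).hom (L.proj p v))
    rw [e1, e2, mul_smul, LinearMap.map_negOnePow_smul]

/-- The homotopy class of the chain map given by a cocycle. -/
noncomputable def cocycleClass (i : ℤ) : L.toCurved.cocycles (overQ D) i
    →ₛₗ[Ideal.Quotient.mk (Ideal.span (Set.range f))] HomShift C D i where
  toFun φ := ShiftedHom.map (M := ℤ) (a := i) (L.cocycleMap φ.1 φ.2)
    (HomotopyCategory.quotient _ _)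
  map_add' φ ψ := by
    have h : L.cocycleMap (φ + ψ).1 (φ + ψ).2 = L.cocycleMap φ.1 φ.2 + L.cocycleMap ψ.1 ψ.2 := by
      ext p : 1
      apply ModuleCat.hom_ext
      change (i * p).negOnePow • L.descend (φ.1 p (p + i) + ψ.1 p (p + i)) = _
      rw [descend_add, smul_add]
      rfl
    rw [h]
    unfold ShiftedHom.map
    rw [Functor.map_add, Preadditive.add_comp]
  map_smul' a φ := by
    have h : L.cocycleMap (a • φ).1 (a • φ).2 =
        Ideal.Quotient.mk (Ideal.span (Set.range f)) a • L.cocycleMap φ.1 φ.2 := by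
      ext p : 1
      apply ModuleCat.hom_ext
      change (i * p).negOnePow • L.descend (a • φ.1 p (p + i)) = _
      rw [descend_smul, smul_comm]
      rfl
    rw [h]
    unfold ShiftedHom.map
    rw [Functor.map_smul, Linear.smul_comp]

theorem cocycleClass_eq_zero {i : ℤ} (φ : L.toCurved.cocycles (overQ D) i)
    (hφ : φ.1 ∈ L.toCurved.boundaries (overQ D) i) : L.cocycleClass i φ = 0 := by
  obtain ⟨h, hh⟩ := hφ
  have key : (HomotopyCategory.quotient _ _).map (L.cocycleMap φ.1 φ.2) =
      (HomotopyCategory.quotient _ _).map 0 := by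
    -- The two factors `(-1)^i` cancel, so the effective sign is `(-1)^(iq)`. Together with the sign
    -- `(-1)^i` of the shifted differential, both terms of the homotopy identity acquire the sign
    -- `(-1)^(ip)` of `cocycleMap`.
    obtain ⟨g, hg⟩ : ∃ g : ∀ p q : ℤ, C.X p ⟶ (D⟦i⟧).X q, ∀ p q, g p q =
        ModuleCat.ofHom ((i * q).negOnePow • i.negOnePow • i.negOnePow • L.descend (h p (q + i))) :=
      ⟨fun p q => _, fun p q => rfl⟩
    apply HomotopyCategory.eq_of_homotopy
    refine
      { hom := fun p q => if q + 1 = p then g p q else 0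
        zero := fun p q hpq => if_neg hpq
        comm := fun p => ?_ }
    rw [dNext_eq _ (show (ComplexShape.up ℤ).Rel p (p + 1) by simp),
      prevD_eq _ (show (ComplexShape.up ℤ).Rel (p - 1) p by simp)]
    rw [if_pos rfl, if_pos (by ring), hg, hg, CochainComplex.shiftFunctor_obj_d']
    apply ModuleCat.hom_ext
    ext x
    obtain ⟨v, rfl⟩ := L.proj_surjective p x
    have e1 := hh p (p - 1 + i) (p + i) rfl (by ring) v
    have e2 : L.descend (φ.1 p (p + i)) (L.proj p v) =
        (D.d (p - 1 + i) (p + i)).hom (L.descend (h p (p - 1 + i)) (L.proj p v)) +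
          L.descend (h (p + 1) (p + i)) ((C.d p (p + 1)).hom (L.proj p v)) := by
      rw [← proj_d, descend_proj, descend_proj, descend_proj]
      exact e1
    have e3 : (i * p).negOnePow = i.negOnePow * (i * (p - 1)).negOnePow := by
      rw [← Int.negOnePow_add]; congr 1; ring
    change (i * p).negOnePow • L.descend (φ.1 p (p + i)) (L.proj p v) =
      (i * p).negOnePow • i.negOnePow • i.negOnePow •
        L.descend (h (p + 1) (p + i)) ((C.d p (p + 1)).hom (L.proj p v)) +
      i.negOnePow • (D.d (p - 1 + i) (p + i)).hom ((i * (p - 1)).negOnePow • i.negOnePow •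
        i.negOnePow • L.descend (h p (p - 1 + i)) (L.proj p v)) + 0
    rw [e2, Int.negOnePow_smul_smul, Int.negOnePow_smul_smul, add_zero, smul_add,
      LinearMap.map_negOnePow_smul, e3, mul_smul, mul_smul]
    exact add_comm _ _
  change (HomotopyCategory.quotient _ _).map (L.cocycleMap φ.1 φ.2) ≫ _ = 0
  rw [key, Functor.map_zero, Limits.zero_comp]

theorem cocycleClass_surjective (i : ℤ) : Function.Surjective (L.cocycleClass (D := D) i) := by
  intro α
  -- Morphisms of the homotopy category are classes of chain maps, once the shift of the quotient is
  -- identified with the quotient of the shift.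
  obtain ⟨a, ha⟩ := (HomotopyCategory.quotient _ _).map_surjective
    (α ≫ ((HomotopyCategory.quotient (ModuleCat.{u} (QuotRing f))
      (ComplexShape.up ℤ)).commShiftIso i).inv.app D)
  let φ : L.toCurved.Cochain (overQ D) := fun p q => if h : p + i = q then
    L.ascend ((i * p).negOnePow • (a.f p ≫ (D.XIsoOfEq h).hom).hom) else 0
  have hφ : ∀ p v, φ p (p + i) v = (i * p).negOnePow • ((a.f p).hom (L.proj p v) : D.X (p + i)) := by
    intro p v
    have : φ p (p + i) = L.ascend ((i * p).negOnePow • (a.f p ≫ (D.XIsoOfEq rfl).hom).hom) :=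
      dif_pos rfl
    rw [this]
    simp [ascend_apply]
    rfl
  have hZ : φ ∈ L.toCurved.cocycles (overQ D) i := by
    rintro p _ r rfl h2 v
    obtain rfl : r = p + 1 + i := by omega
    rw [hφ, hφ, proj_d]
    have h := a.comm p (p + 1)
    rw [CochainComplex.shiftFunctor_obj_d'] at h
    have h1 := LinearMap.congr_fun (congrArg ModuleCat.Hom.hom h) (L.proj p v)
    have h2 : i.negOnePow • (D.d (p + i) (p + 1 + i)).hom ((a.f p).hom (L.proj p v)) =
      (a.f (p + 1)).hom ((C.d p (p + 1)).hom (L.proj p v)) := h1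
    have e2 : (i * (p + 1)).negOnePow = (i * p).negOnePow * i.negOnePow := by
      rw [← Int.negOnePow_add]; congr 1; ring
    rw [← h2, e2]
    change (D.d (p + i) (p + 1 + i)).hom ((i * p).negOnePow • ((a.f p).hom (L.proj p v))) =
      ((i * p).negOnePow * i.negOnePow) •
        i.negOnePow • (D.d (p + i) (p + 1 + i)).hom ((a.f p).hom (L.proj p v))
    rw [mul_smul, Int.negOnePow_smul_smul]
    exact LinearMap.map_negOnePow_smul _ _ _
  refine ⟨⟨φ, hZ⟩, ?_⟩
  have hcm : L.cocycleMap φ hZ = a := by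
    ext p : 1
    apply ModuleCat.hom_ext
    ext x
    obtain ⟨v, rfl⟩ := L.proj_surjective p x
    change (i * p).negOnePow • L.descend (φ p (p + i)) (L.proj p v) = (a.f p).hom (L.proj p v)
    rw [descend_proj, hφ]
    exact Int.negOnePow_smul_smul (V := D.X (p + i)) _ _
  change (HomotopyCategory.quotient _ _).map (L.cocycleMap φ hZ) ≫ _ = α
  rw [hcm, ha, Category.assoc]
  have : ((HomotopyCategory.quotient (ModuleCat.{u} (QuotRing f))
      (ComplexShape.up ℤ)).commShiftIso i).inv.app D ≫
    ((HomotopyCategory.quotient (ModuleCat.{u} (QuotRing f))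
      (ComplexShape.up ℤ)).commShiftIso i).hom.app D = 𝟙 _ := Iso.inv_hom_id_app _ _
  exact (congrArg (α ≫ ·) this).trans (Category.comp_id _)

end Lift

end TotallyAcyclic

namespace TotallyAcyclic

variable {Q : Type u} [CommRing Q] {c : ℕ} {f : Fin c → Q}

/-- This identifies composition with `t_k` on cochains with the operator on homotopy classes. The
signs agree because `t_k` has even degree: `(i + 2)p` and `i(p + 2)` have the same parity. -/
theorem Lift.cocycleClass_compT {C D : CochainComplex (ModuleCat.{u} (QuotRing f)) ℤ}
    (L : Lift f C) (hf : RingTheory.Sequence.IsWeaklyRegular Q (List.ofFn f)) (k : Fin c) {i j : ℤ}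
    (hij : i + 2 = j) (φ : L.toCurved.Cochain (overQ D))
    (hφ : φ ∈ L.toCurved.cocycles (overQ D) i)
    (hφ' : L.toCurved.compT k φ ∈ L.toCurved.cocycles (overQ D) j) :
    L.cocycleClass j ⟨L.toCurved.compT k φ, hφ'⟩ =
      (L.operator hf k).comp (L.cocycleClass i ⟨φ, hφ⟩) hij := by
  subst hij
  have h : L.cocycleMap (L.toCurved.compT k φ) hφ' =
      ShiftedHom.comp (M := ℤ) (a := 2) (b := i) (L.chainMap hf k) (L.cocycleMap φ hφ) rfl := by
    ext p : 1
    unfold ShiftedHom.comp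
    rw [HomologicalComplex.comp_f, HomologicalComplex.comp_f,
      CochainComplex.shiftFunctorAdd'_inv_app_f', CochainComplex.shiftFunctor_map_f']
    apply ModuleCat.hom_ext
    ext x
    obtain ⟨v, rfl⟩ := L.proj_surjective p x
    -- The indices `p + 2` and `p + 1 + 1` are not syntactically equal. Stating the identity for
    -- variable indices allows substitution, after which the transport along `XIsoOfEq` is trivial.
    have key : ∀ m n (hm : m = p + 1 + 1) (hn : m + i = n),
        ((i * m).negOnePow • ((D.XIsoOfEq hn).hom.hom
          (L.descend (φ m (m + i)) (L.op k p m (L.proj p v)))) : D.X n) =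
        (i * m).negOnePow • (φ (p + 1 + 1) n (L.toCurved.t k p v) : D.X n) := by
      rintro _ _ rfl rfl
      rw [← proj_t, descend_proj]
      rfl
    have h2 := key (p + 2) (p + (i + 2)) (by ring) (by ring)
    have e : ((i + 2) * p).negOnePow = (i * (p + 2)).negOnePow := by
      rw [Int.negOnePow_eq_iff]
      exact ⟨p - i, by ring⟩
    change ((i + 2) * p).negOnePow • L.descend (L.toCurved.compT k φ p (p + (i + 2)))
      (L.proj p v) = (D.XIsoOfEq _).hom.hom ((i * (p + 2)).negOnePow •
        L.descend (φ (p + 2) (p + 2 + i)) (L.op k p (p + 2) (L.proj p v)))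
    rw [LinearMap.map_negOnePow_smul, descend_proj, e]
    exact h2.symm
  exact (congrArg (fun z => ShiftedHom.map (M := ℤ) (a := i + 2) z
    (HomotopyCategory.quotient (ModuleCat.{u} (QuotRing f)) (ComplexShape.up ℤ))) h).trans
      (ShiftedHom.map_comp (M := ℤ) (a := 2) (b := i) (c := i + 2) _ _ _ _)

/-- The cohomology of the lifted complex is finite over `Q` and maps onto `Hom_R(C, Σ^i D)`,
semilinearly along the surjection `Q → R`. -/
theorem finite_homShift [IsNoetherianRing Q] (C D : Ktac (QuotRing f)) (i : ℤ) :
    Module.Finite (QuotRing f) (HomShift C.X D.X i) := by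
  obtain ⟨L⟩ := Lift.nonempty (f := f) C.free C.finite
  have := L.finite_cohomology (D := D) i
  obtain ⟨S, hS⟩ := Module.Finite.fg_top (R := Q) (M := L.toCurved.Cohomology (overQ D.X) i)
  let g : L.toCurved.Cohomology (overQ D.X) i
      →ₛₗ[Ideal.Quotient.mk (Ideal.span (Set.range f))] HomShift C.X D.X i :=
    Submodule.liftQ _ (L.cocycleClass i) fun φ hφ => L.cocycleClass_eq_zero φ hφ
  have hg : Function.Surjective g := fun α => by
    obtain ⟨φ, rfl⟩ := L.cocycleClass_surjective i α
    exact ⟨Submodule.Quotient.mk φ, rfl⟩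
  classical
  refine ⟨⟨S.image g, ?_⟩⟩
  have : RingHomSurjective (Ideal.Quotient.mk (Ideal.span (Set.range f))) :=
    ⟨Ideal.Quotient.mk_surjective⟩
  rw [Finset.coe_image, ← Submodule.map_span, hS, Submodule.map_top, LinearMap.range_eq_top.2 hg]

/-- In large degrees the modules `Hom_R(C, Σ^i D)` are generated by the values of the cohomology
operators. -/
theorem exists_eq_sum_chiDeg [IsRegularLocalRing Q]
    [hf : Fact (RingTheory.Sequence.IsRegular Q (List.ofFn f))] (C D : Ktac (QuotRing f)) :
    ∃ n : ℕ, ∀ i : ℕ, n ≤ i →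
    ∀ α : HomShift C.X D.X ((i + 2 : ℕ) : ℤ), ∃ β : Fin c → HomShift C.X D.X (i : ℤ),
      α = ∑ k, chiDeg f C D k i (β k) := by
  obtain ⟨L⟩ := Lift.nonempty (f := f) C.free C.finite
  have hf' := hf.out.toIsWeaklyRegular
  have hD := smul_overQ_eq_zero (f := f) D.X
  obtain ⟨n, hn⟩ := CurvedComplex.eventuallyGenerated f hf' L.toCurved
    (L.exactModulo_toCurved C.exact) hD (L.finite_cohomology (D := D))
  refine ⟨n, fun i hi α => ?_⟩
  obtain ⟨φ, rfl⟩ := L.cocycleClass_surjective _ α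
  obtain ⟨y, hy⟩ := hn i hi (Submodule.Quotient.mk φ)
  choose ψ hψ using fun k => Submodule.Quotient.mk_surjective _ (y k)
  have hij : (i : ℤ) + 2 = ((i + 2 : ℕ) : ℤ) := by push_cast; rfl
  let T : Fin c → L.toCurved.cocycles (overQ D.X) ((i + 2 : ℕ) : ℤ) := fun k =>
    ⟨L.toCurved.compT k (ψ k).1, CurvedComplex.compT_mem_cocycles hf' hD k hij _ (ψ k).2⟩
  have h0 : Submodule.Quotient.mk (p := (L.toCurved.boundaries (overQ D.X) ((i + 2 : ℕ) : ℤ)).submoduleOf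
      (L.toCurved.cocycles (overQ D.X) ((i + 2 : ℕ) : ℤ))) (φ - ∑ k, T k) = 0 := by
    rw [Submodule.Quotient.mk_sub, hy, sub_eq_zero, ← Submodule.mkQ_apply _ (∑ k, T k), map_sum]
    refine Finset.sum_congr rfl fun k _ => ?_
    rw [← hψ k]
    rfl
  have h0' := (Submodule.Quotient.mk_eq_zero _).1 h0
  have h1 := L.cocycleClass_eq_zero (φ - ∑ k, T k) h0'
  rw [map_sub, map_sum, sub_eq_zero] at h1
  refine ⟨fun k => L.cocycleClass _ (ψ k), h1.trans (Finset.sum_congr rfl fun k _ => ?_)⟩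
  refine (L.cocycleClass_compT hf' k hij _ (ψ k).2 _).trans ?_
  rw [← eisenbud_eq f C L k]
  rfl

end TotallyAcyclic

/-! ### Nakayama, the Nullstellensatz and the conclusion. -/

/-- A finitely generated module over a local ring vanishes if its tensor product with a nontrivial
quotient of the ring does. -/
theorem IsLocalRing.eq_zero_of_tmul_eq_zero {R k : Type*} [CommRing R] [IsLocalRing R] [CommRing k]
    [Nontrivial k] [Algebra R k] (hk : Function.Surjective (algebraMap R k)) {H : Type*}
    [AddCommGroup H] [Module R H] [Module.Finite R H]
    (h : ∀ x : H, TensorProduct.tmul R (1 : k) x = 0) (x : H) : x = 0 := by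
  set J := RingHom.ker (Algebra.ofId R k) with hJ
  let e : (R ⧸ J) ≃ₗ[R] k := (Ideal.quotientKerAlgEquivOfSurjective
    (f := Algebra.ofId R k) hk).toLinearEquiv
  -- The module `k ⊗ H` is `H / JH`, with `J` the kernel of `R → k`; its vanishing says `H = JH`.
  have hzero : ∀ y : H, y ∈ J • (⊤ : Submodule R H) := by
    intro y
    have h1 : TensorProduct.tmul R (1 : R ⧸ J) y = 0 := by
      apply (TensorProduct.congr e (LinearEquiv.refl R H)).injective
      rw [TensorProduct.congr_tmul, map_zero]
      have : e 1 = 1 := map_one (Ideal.quotientKerAlgEquivOfSurjective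
        (f := Algebra.ofId R k) hk)
      rw [this]
      exact h y
    have h2 := TensorProduct.quotTensorEquivQuotSMul_mk_tmul J (1 : R) y
    rw [map_one, h1, map_zero, one_smul] at h2
    exact (Submodule.Quotient.mk_eq_zero _).1 h2.symm
  have hbot : (⊤ : Submodule R H) = ⊥ :=
    Submodule.eq_bot_of_le_smul_of_le_jacobson_bot J _ Module.Finite.fg_top (fun y _ => hzero y) (by
      rw [IsLocalRing.jacobson_eq_maximalIdeal _ bot_ne_top]
      exact IsLocalRing.le_maximalIdeal (RingHom.ker_ne_top _))
  exact (Submodule.mem_bot R).1 (hbot ▸ Submodule.mem_top)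

namespace TotallyAcyclic

open TensorProduct in
theorem supportAction_X_pow_tmul {Q : Type u} [CommRing Q] [IsLocalRing Q] {c : ℕ} (f : Fin c → Q)
    [Fact (RingTheory.Sequence.IsRegular Q (List.ofFn f))] (C D : Ktac (QuotRing f)) (j : Fin c)
    (m : ℕ) (a : IsLocalRing.ResidueField Q) (h : HomSum f C D) :
    supportAction f C D (MvPolynomial.X j ^ m) (a ⊗ₜ h) = a ⊗ₜ ((chi f C D j ^ m) h) := by
  induction m generalizing h with
  | zero => simp
  | succ m ih =>
    rw [pow_succ, map_mul, Module.End.mul_apply, supportAction_X_tmul, ih, pow_succ,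
      Module.End.mul_apply]

section

variable {Q : Type u} [CommRing Q] {c : ℕ} (f : Fin c → Q)
  [Fact (RingTheory.Sequence.IsRegular Q (List.ofFn f))] (C D : Ktac (QuotRing f))

theorem exists_chi_pow_lof (j : Fin c) (m i : ℕ) (α : HomShift C.X D.X (i : ℤ)) :
    ∃ β : HomShift C.X D.X ((i + 2 * m : ℕ) : ℤ), (chi f C D j ^ m)
      (DirectSum.lof (QuotRing f) ℕ (fun i => HomShift C.X D.X (i : ℤ)) i α) =
        DirectSum.lof (QuotRing f) ℕ (fun i => HomShift C.X D.X (i : ℤ)) (i + 2 * m) β := by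
  induction m with
  | zero => exact ⟨α, rfl⟩
  | succ m ih =>
    obtain ⟨β, hβ⟩ := ih
    refine ⟨chiDeg f C D j _ β, ?_⟩
    rw [pow_succ', Module.End.mul_apply, hβ, chi_lof]
    rfl

end

section Support

variable {Q : Type u} [CommRing Q] [IsLocalRing Q] {c : ℕ} (f : Fin c → Q)
  [Fact (RingTheory.Sequence.IsRegular Q (List.ofFn f))] (C D : Ktac (QuotRing f))

open IsLocalRing

theorem algebraMap_residueField_surjective :
    Function.Surjective (algebraMap (QuotRing f) (ResidueField Q)) := by
  intro x
  obtain ⟨a, rfl⟩ := IsLocalRing.residue_surjective x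
  exact ⟨Ideal.Quotient.mk _ a, Ideal.Quotient.lift_mk _ _ _⟩

/-- If `Hom_R(C, Σ^i D)` vanishes in large degrees, then the support variety is trivial. -/
theorem supportVariety_eq_zero_of_vanishing {N : ℤ}
    (h : ∀ i : ℤ, N ≤ i → ∀ α : HomShift C.X D.X i, α = 0) : supportVariety f C D = {0} := by
  ext b
  refine ⟨fun hb => ?_, fun hb => Or.inr hb⟩
  rcases hb with hb | hb
  · funext j
    -- This power raises degrees by `2 (N.toNat + 1) ≥ N`, so it kills `E`. The `+ 1` keeps the
    -- exponent positive, so that a vanishing power of a coordinate forces the coordinate to vanish.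
    have h1 := hb (MvPolynomial.X j ^ (N.toNat + 1)) (by
      intro e
      induction e using TensorProduct.induction_on with
      | zero => rw [map_zero]
      | add x y hx hy => rw [map_add, hx, hy, add_zero]
      | tmul a x =>
        rw [supportAction_X_pow_tmul]
        induction x using DirectSum.induction_on with
        | zero => rw [map_zero, TensorProduct.tmul_zero]
        | add x y hx hy => rw [map_add, TensorProduct.tmul_add, hx, hy, add_zero]
        | of i α =>
          obtain ⟨β, hβ⟩ := exists_chi_pow_lof f C D j (N.toNat + 1) i α
          rw [← DirectSum.lof_eq_of (QuotRing f), hβ, h _ (by push_cast; omega) β, map_zero,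
            TensorProduct.tmul_zero])
    rw [map_pow, MvPolynomial.eval_X] at h1
    exact pow_eq_zero_iff (Nat.succ_ne_zero _) |>.1 h1
  · exact hb

/-- If the support variety is trivial, a power of the ideal of the operators kills `E`. -/
theorem exists_pow_le_ker [IsAlgClosed (ResidueField Q)] (h : supportVariety f C D = {0}) :
    ∃ s, (Ideal.span (Set.range fun j : Fin c =>
      (MvPolynomial.X j : MvPolynomial (Fin c) (ResidueField Q)))) ^ s ≤
        RingHom.ker (supportAction f C D) := by
  apply Ideal.exists_pow_le_of_le_radical_of_fg _ (Submodule.fg_span (Set.finite_range _))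
  -- By the Nullstellensatz it is enough that the coordinates vanish on the zero locus of the
  -- annihilator, which is contained in the support variety and hence in the origin.
  rw [← MvPolynomial.vanishingIdeal_zeroLocus_eq_radical (K := ResidueField Q), Ideal.span_le]
  rintro _ ⟨j, rfl⟩
  rw [SetLike.mem_coe, MvPolynomial.mem_vanishingIdeal_iff]
  intro b hb
  have hb' : b ∈ supportVariety f C D := Or.inl fun φ hφ => by
    have := hb φ (LinearMap.ext hφ)
    rwa [MvPolynomial.aeval_eq_eval] at this
  rw [h] at hb'
  rw [MvPolynomial.aeval_X, Set.mem_singleton_iff.1 hb']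
  rfl

open TensorProduct in
/-- The elements of `E` of high degree are obtained from elements of `E` by many operators. -/
theorem tmul_lof_mem_closure {n : ℕ} (hn : ∀ i : ℕ, n ≤ i →
      ∀ α : HomShift C.X D.X ((i + 2 : ℕ) : ℤ), ∃ β : Fin c → HomShift C.X D.X (i : ℤ),
        α = ∑ k, chiDeg f C D k i (β k)) (s i : ℕ) (hi : n + 2 * s ≤ i)
    (α : HomShift C.X D.X (i : ℤ)) :
    (1 : ResidueField Q) ⊗ₜ[QuotRing f]
      DirectSum.lof (QuotRing f) ℕ (fun i => HomShift C.X D.X (i : ℤ)) i α ∈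
        AddSubgroup.closure {y | ∃ a ∈ (Ideal.span (Set.range fun j : Fin c =>
          (MvPolynomial.X j : MvPolynomial (Fin c) (ResidueField Q)))) ^ s,
            ∃ e, y = supportAction f C D a e} := by
  induction s generalizing i with
  | zero =>
    exact AddSubgroup.subset_closure ⟨1, by simp, (1 : ResidueField Q) ⊗ₜ[QuotRing f]
      DirectSum.lof (QuotRing f) ℕ (fun i => HomShift C.X D.X (i : ℤ)) i α,
      by rw [map_one, Module.End.one_apply]⟩
  | succ s ih =>
    obtain ⟨i, rfl⟩ : ∃ i', i = i' + 2 := ⟨i - 2, by omega⟩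
    obtain ⟨β, rfl⟩ := hn i (by omega) α
    rw [map_sum, TensorProduct.tmul_sum]
    refine AddSubgroup.sum_mem _ fun k _ => ?_
    rw [← chi_lof, ← supportAction_X_tmul]
    have h := ih i (by omega) (β k)
    generalize (1 : ResidueField Q) ⊗ₜ[QuotRing f]
      DirectSum.lof (QuotRing f) ℕ (fun i => HomShift C.X D.X (i : ℤ)) i (β k) = z at h ⊢
    induction h using AddSubgroup.closure_induction with
    | mem y hy =>
      obtain ⟨a, ha, e, rfl⟩ := hy
      refine AddSubgroup.subset_closure ⟨MvPolynomial.X k * a, ?_, e, ?_⟩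
      · rw [pow_succ']
        exact Ideal.mul_mem_mul (Ideal.subset_span ⟨k, rfl⟩) ha
      · rw [map_mul, Module.End.mul_apply]
    | zero => rw [map_zero]; exact zero_mem _
    | add x y _ _ hx hy => rw [map_add]; exact add_mem hx hy
    | neg x _ hx => rw [map_neg]; exact neg_mem hx

end Support

end TotallyAcyclic

theorem theorem6p1 {Q : Type u} [CommRing Q] [IsRegularLocalRing Q]
    [IsAlgClosed (IsLocalRing.ResidueField Q)] {c : ℕ} (f : Fin c → Q)
    [Fact (RingTheory.Sequence.IsRegular Q (List.ofFn f))]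
    (C D : TotallyAcyclic.Ktac (TotallyAcyclic.QuotRing f)) :
    (∃ N : ℤ, ∀ i : ℤ, N ≤ i → ∀ α : TotallyAcyclic.HomShift C.X D.X i, α = 0) ↔
      TotallyAcyclic.supportVariety f C D = {0} := by
  refine ⟨fun ⟨N, hN⟩ => TotallyAcyclic.supportVariety_eq_zero_of_vanishing f C D hN, fun h => ?_⟩
  obtain ⟨s, hs⟩ := TotallyAcyclic.exists_pow_le_ker f C D h
  obtain ⟨n, hn⟩ := TotallyAcyclic.exists_eq_sum_chiDeg C D
  have : Nontrivial (TotallyAcyclic.QuotRing f) :=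
    Ideal.Quotient.nontrivial_iff.2 (TotallyAcyclic.span_ne_top f Fact.out)
  have : IsLocalRing (TotallyAcyclic.QuotRing f) :=
    .of_surjective' _ Ideal.Quotient.mk_surjective
  -- From this degree on, an element can be pulled back through `s` operators of degree two without
  -- leaving the range `≥ n` where generation holds.
  refine ⟨(n + 2 * s : ℕ), fun i hi => ?_⟩
  lift i to ℕ using by omega
  have := TotallyAcyclic.finite_homShift C D i
  refine IsLocalRing.eq_zero_of_tmul_eq_zero (k := IsLocalRing.ResidueField Q)
    (TotallyAcyclic.algebraMap_residueField_surjective f) fun α => ?_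
  have h0 := TotallyAcyclic.tmul_lof_mem_closure f C D hn s i (by exact_mod_cast hi) α
  have hset : {y | ∃ a ∈ (Ideal.span (Set.range fun j : Fin c =>
      (MvPolynomial.X j : MvPolynomial (Fin c) (IsLocalRing.ResidueField Q)))) ^ s,
        ∃ e, y = TotallyAcyclic.supportAction f C D a e} ⊆ {0} := by
    rintro _ ⟨a, ha, e, rfl⟩
    exact LinearMap.congr_fun (hs ha) e
  have h1 := AddSubgroup.closure_mono hset h0
  rw [AddSubgroup.closure_singleton_zero, AddSubgroup.mem_bot] at h1
  -- Projecting to the component of degree `i` recovers `1 ⊗ α` in `k ⊗ Hom_R(C, Σ^i D)` from its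
  -- image in `E`.
  have h2 := congrArg (LinearMap.lTensor (IsLocalRing.ResidueField Q)
    (DirectSum.component (TotallyAcyclic.QuotRing f) ℕ
      (fun i => TotallyAcyclic.HomShift C.X D.X (i : ℤ)) i)) h1
  rwa [map_zero, LinearMap.lTensor_tmul, DirectSum.component.lof_self] at h2
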